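/- Let $K$ be an imaginary quadratic field, $\overline{K}$ an algebraic closure of $K$, and $p \geq 5$ a prime number that splits in $K$ as $(p) = \mathfrak{p}\overline{\mathfrak{p}}$ with $\mathfrak{p} \neq \overline{\mathfrak{p}}$. Let $E$ be an elliptic curve over $\mathbb{Q}$ with good reduction at $p$ and with complex multiplication by the ring of integers $\mathcal{O}_K$ of $K$, the action being given by a ring isomorphism $\mathcal{O}_K \simeq \mathrm{End}_K(E)$, $a \mapsto [a]$. Put $E[\mathfrak{p}^{\infty}] = \{P \in E(\overline{K}) : \exists n \geq 0,\ [a]P = 0 \text{ for all } a \in \mathfrak{p}^n\}$; this is a discrete $\mathrm{Gal}(\overline{K}/K)$-module. Let $L \subset \overline{K}$ be a finite abelian extension of $K$ and let $L^{\mathfrak{p}} = L(E[\mathfrak{p}^{\infty}])$ be the field generated over $L$ by the coordinates of the points of $E[\mathfrak{p}^{\infty}]$. Let $S$ be a finite set of finite places of $K$ with $\mathfrak{p} \in S$ and $\overline{\mathfrak{p}} \notin S$. For $F \in \{L, L^{\mathfrak{p}}\}$ define the $S$-imprimitive Selmer group $$\mathrm{Sel}_S(E/F)[\mathfrak{p}^{\infty}]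 = \ker\Big( H^1(F, E[\mathfrak{p}^{\infty}]) \to \prod_{v \notin S} H^1(F \otimes_K K_v, E[\mathfrak{p}^{\infty}]) \Big),$$ where $v$ runs over the finite places of $K$ outside $S$ (so $v = \overline{\mathfrak{p}}$ is included) and $H^1$ is continuous Galois cohomology; the kernel consists of the classes whose restriction to $H^1(F_w, E[\mathfrak{p}^{\infty}])$ vanishes for every place $w$ of $F$ above a finite place $v \notin S$ of $K$. Then the restriction map $H^1(L, E[\mathfrak{p}^{\infty}]) \to H^1(L^{\mathfrak{p}}, E[\mathfrak{p}^{\infty}])$ induces an isomorphism of abelian groups $$\mathrm{Sel}_S(E/L)[\mathfrak{p}^{\infty}] \overset{\sim}{\longrightarrow} \big(\mathrm{Sel}_S(E/L^{\mathfrak{p}})[\mathfrak{p}^{\infty}]\big)^{\mathrm{Gal}(L^{\mathfrak{p}}/L)},$$ and the restriction map commutes with the action of $\mathrm{Gal}(\overline{K}/K)$ on both cohomology groups. -/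

import Mathlib

open NumberField IsDedekindDomain

universe u v w

section Cohomology

/-- Continuous 1-cocycles (crossed homomorphisms) of a topological group `G` with values in the
discrete `G`-module `A`; the action is given by `ρ`, and a map to a discrete space is continuous
exactly when it is locally constant. -/
def contZ1 {G : Type*} {A : Type*} [Group G] [TopologicalSpace G] [AddCommGroup A]
    (ρ : G →* AddMonoid.End A) : AddSubgroup (G → A) where
  carrier := {f | IsLocallyConstant f ∧ ∀ g h, f (g * h) = f g + ρ g (f h)}
  zero_mem' := ⟨IsLocallyConstant.const 0, fun g h => by simp⟩
  add_mem' := by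
    rintro a b ⟨ha, ha'⟩ ⟨hb, hb'⟩
    refine ⟨ha.add hb, fun g h => ?_⟩
    simp only [Pi.add_apply, ha', hb', map_add]
    abel
  neg_mem' := by
    rintro a ⟨ha, ha'⟩
    refine ⟨ha.neg, fun g h => ?_⟩
    simp only [Pi.neg_apply, ha', map_neg]
    abel

/-- 1-coboundaries (principal crossed homomorphisms). -/
def contB1 {G : Type*} {A : Type*} [Group G] [AddCommGroup A]
    (ρ : G →* AddMonoid.End A) : AddSubgroup (G → A) where
  carrier := {f | ∃ a : A, ∀ g, f g = ρ g a - a}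
  zero_mem' := ⟨0, fun g => by simp⟩
  add_mem' := by
    rintro a b ⟨x, hx⟩ ⟨y, hy⟩
    refine ⟨x + y, fun g => ?_⟩
    simp only [Pi.add_apply, hx, hy, map_add]
    abel
  neg_mem' := by
    rintro a ⟨x, hx⟩
    refine ⟨-x, fun g => ?_⟩
    simp only [Pi.neg_apply, hx, map_neg]
    abel

/-- The first continuous cohomology group `H¹(G, A)` of the discrete `G`-module `A`. -/
abbrev contH1 {G : Type*} {A : Type*} [Group G] [TopologicalSpace G] [AddCommGroup A]
    (ρ : G →* AddMonoid.End A) : Type _ :=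
  contZ1 ρ ⧸ (contB1 ρ).addSubgroupOf (contZ1 ρ)

/-- The functoriality of cocycles for a pair of compatible maps `φ : H → G` and `u : A → B`. -/
def contZ1Map {G H : Type*} {A B : Type*} [Group G] [TopologicalSpace G] [Group H]
    [TopologicalSpace H] [AddCommGroup A] [AddCommGroup B]
    (ρ : G →* AddMonoid.End A) (ρ' : H →* AddMonoid.End B)
    (φ : H →* G) (hφ : Continuous φ) (u : A →+ B) (hu : ∀ h a, u (ρ (φ h) a) = ρ' h (u a)) :
    contZ1 ρ →+ contZ1 ρ' where
  toFun f := ⟨fun h => u (f.1 (φ h)),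
    ((f.2.1.comp_continuous hφ).comp u), fun g h => by simp [f.2.2, hu]⟩
  map_zero' := by ext; simp
  map_add' a b := by ext; simp

/-- The map `H¹(G, A) → H¹(H, B)`, `[f] ↦ [u ∘ f ∘ φ]`, for a pair of compatible maps
`φ : H → G` and `u : A → B`. -/
def contH1Map {G H : Type*} {A B : Type*} [Group G] [TopologicalSpace G] [Group H]
    [TopologicalSpace H] [AddCommGroup A] [AddCommGroup B]
    (ρ : G →* AddMonoid.End A) (ρ' : H →* AddMonoid.End B)
    (φ : H →* G) (hφ : Continuous φ) (u : A →+ B) (hu : ∀ h a, u (ρ (φ h) a) = ρ' h (u a)) :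
    contH1 ρ →+ contH1 ρ' :=
  QuotientAddGroup.map _ _ (contZ1Map ρ ρ' φ hφ u hu) (by
    rintro f ⟨a, ha⟩
    refine ⟨u a, fun h => ?_⟩
    have h1 : f.1 (φ h) = ρ (φ h) a - a := ha (φ h)
    change u (f.1 (φ h)) = _
    rw [h1, map_sub, hu])

end Cohomology

section Galois

variable {K : Type u} {Kbar : Type v} [Field K] [Field Kbar] [Algebra K Kbar]
  {A : Type w} [AddCommGroup A]

/-- `H¹(F, A)`: the continuous cohomology of `Gal(Kbar/F)` with values in the
`Gal(Kbar/K)`-module `A`, for an intermediate field `F` of `Kbar/K`. -/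
abbrev galH1 (ρ : Gal(Kbar/K) →* AddMonoid.End A) (F : IntermediateField K Kbar) : Type _ :=
  contH1 (ρ.comp F.fixingSubgroup.subtype)

/-- The restriction map `H¹(F, A) → H¹(F', A)` for `F ≤ F'`. -/
def galRes (ρ : Gal(Kbar/K) →* AddMonoid.End A) {F F' : IntermediateField K Kbar} (h : F ≤ F') :
    galH1 ρ F →+ galH1 ρ F' :=
  contH1Map _ _ (Subgroup.inclusion (IntermediateField.fixingSubgroup_antitone h))
    (continuous_inclusion (IntermediateField.fixingSubgroup_antitone h))
    (AddMonoidHom.id A) (fun _ _ => rfl)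

/-- The action of `σ ∈ Gal(Kbar/K)` on `H¹(F, A)` for `F/K` Galois: the class of `f` is sent
to the class of `g ↦ σ f(σ⁻¹ g σ)`. It only depends on the restriction of `σ` to `F`, and this is
the usual action of `Gal(F/K)` on `H¹(F, A)`. -/
def galConj [IsGalois K Kbar] (ρ : Gal(Kbar/K) →* AddMonoid.End A) (F : IntermediateField K Kbar)
    [IsGalois K F] (σ : Gal(Kbar/K)) : galH1 ρ F →+ galH1 ρ F :=
  contH1Map _ _ (MulAut.conjNormal (H := F.fixingSubgroup) σ⁻¹).toMonoidHom
    (by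
      refine Continuous.subtype_mk (f := fun g : F.fixingSubgroup => σ⁻¹ * (g : Gal(Kbar/K)) * σ⁻¹⁻¹) ?_ _
      fun_prop)
    (ρ σ) (by
      intro g a
      change ρ σ (ρ ((MulAut.conjNormal σ⁻¹ g : F.fixingSubgroup) : Gal(Kbar/K)) a) = ρ g (ρ σ a)
      have h1 : σ * (σ⁻¹ * (g : Gal(Kbar/K)) * σ⁻¹⁻¹) = g * σ := by group
      rw [MulAut.conjNormal_apply]
      change (ρ σ * ρ (σ⁻¹ * (g : Gal(Kbar/K)) * σ⁻¹⁻¹)) a = (ρ g * ρ σ) a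
      rw [← map_mul, h1, map_mul])

end Galois

section Local

variable {K : Type u} {Kbar : Type v} [Field K] [Field Kbar] [Algebra K Kbar] [Normal K Kbar]
  {Kv : Type u} {Ω : Type w} [Field Kv] [Field Ω] [Algebra K Kv] [Algebra Kv Ω] [Algebra K Ω]
  [IsScalarTower K Kv Ω]

/-- For a `K`-embedding `τ : Kbar → Ω` of a normal extension of `K`, the homomorphism
`Gal(Ω/Kv) → Gal(Kbar/K)`, `g ↦ τ⁻¹ ∘ g ∘ τ`. -/
noncomputable def localToGlobal (τ : Kbar →ₐ[K] Ω) : Gal(Ω/Kv) →* Gal(Kbar/K) :=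
  letI : Algebra Kbar Ω := τ.toRingHom.toAlgebra
  haveI : IsScalarTower K Kbar Ω := IsScalarTower.of_algebraMap_eq' τ.comp_algebraMap.symm
  (AlgEquiv.restrictNormalHom Kbar).comp (MonoidHom.mk' (fun g : Gal(Ω/Kv) => g.restrictScalars K) (fun _ _ => rfl))

lemma apply_localToGlobal (τ : Kbar →ₐ[K] Ω) (g : Gal(Ω/Kv)) (x : Kbar) :
    τ (localToGlobal τ g x) = g (τ x) := by
  let _ : Algebra Kbar Ω := τ.toRingHom.toAlgebra
  have : IsScalarTower K Kbar Ω := IsScalarTower.of_algebraMap_eq' τ.comp_algebraMap.symm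
  exact AlgEquiv.restrictNormal_commutes (g.restrictScalars K) Kbar x

lemma continuous_localToGlobal (τ : Kbar →ₐ[K] Ω) :
    Continuous (localToGlobal τ : Gal(Ω/Kv) →* Gal(Kbar/K)) := by
  refine continuous_of_continuousAt_one _ ?_
  rw [ContinuousAt, map_one]
  intro U hU
  obtain ⟨E, hE, hEU⟩ := (krullTopology_mem_nhds_one_iff K Kbar U).1 hU
  rw [Filter.mem_map, krullTopology_mem_nhds_one_iff]
  have hEfg : E.FG :=
    IntermediateField.fg_of_fg_toSubalgebra E (Subalgebra.fg_of_fg_toSubmodule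
      (Module.Finite.iff_fg.1 (inferInstanceAs (Module.Finite K E))))
  obtain ⟨s, hs⟩ := hEfg
  refine ⟨IntermediateField.adjoin Kv (τ '' s), ?_, fun g hg => hEU ?_⟩
  · have : Finite (τ '' (s : Set Kbar)) := (s.finite_toSet.image τ).to_subtype
    refine IntermediateField.finiteDimensional_adjoin ?_
    rintro _ ⟨x, -, rfl⟩
    have h1 : IsIntegral K (τ x) := (Normal.isIntegral (F := K) inferInstance x).map τ
    exact h1.tower_top
  · change localToGlobal τ g ∈ E.fixingSubgroup
    rintro ⟨x, hx⟩
    change localToGlobal τ g x = x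
    rw [← hs] at hx
    induction hx using IntermediateField.adjoin_induction with
    | mem x hx =>
      apply τ.injective
      refine (apply_localToGlobal τ g x).trans ?_
      exact hg ⟨τ x, IntermediateField.subset_adjoin _ _ ⟨x, hx, rfl⟩⟩
    | algebraMap x => exact AlgEquiv.commutes _ x
    | add x y _ _ hx hy => rw [map_add, hx, hy]
    | inv x _ hx => rw [map_inv₀, hx]
    | mul x y _ _ hx hy => rw [map_mul, hx, hy]

/-- The compositum `Kv · τ(F)` inside `Ω`. -/
abbrev localField (Kv : Type u) [Field Kv] [Algebra K Kv] [Algebra Kv Ω] [IsScalarTower K Kv Ω]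
    (τ : Kbar →ₐ[K] Ω) (F : IntermediateField K Kbar) : IntermediateField Kv Ω :=
  IntermediateField.adjoin Kv (τ '' F)

/-- Restriction `Gal(Ω / Kv · τ(F)) → Gal(Kbar/F)` along `τ`. -/
noncomputable def localToGlobalOver (Kv : Type u) [Field Kv] [Algebra K Kv] [Algebra Kv Ω]
    [IsScalarTower K Kv Ω] (τ : Kbar →ₐ[K] Ω) (F : IntermediateField K Kbar) :
    (localField Kv τ F).fixingSubgroup →* F.fixingSubgroup :=
  ((localToGlobal τ).comp (localField Kv τ F).fixingSubgroup.subtype).codRestrict _ (by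
    rintro g ⟨x, hx⟩
    apply τ.injective
    refine (apply_localToGlobal τ g.1 x).trans ?_
    exact g.2 ⟨τ x, IntermediateField.subset_adjoin _ _ ⟨x, hx, rfl⟩⟩)

lemma continuous_localToGlobalOver (τ : Kbar →ₐ[K] Ω) (F : IntermediateField K Kbar) :
    Continuous (localToGlobalOver Kv τ F) :=
  ((continuous_localToGlobal τ).comp continuous_subtype_val).subtype_mk _

variable {A : Type*} [AddCommGroup A]

/-- `H¹(F_w, A)` where `F_w = Kv · τ(F)` and the `Gal(Kbar/K)`-module `A` is regarded as a
`Gal(Ω/F_w)`-module through `τ`. -/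
abbrev localH1 (Kv : Type u) [Field Kv] [Algebra K Kv] [Algebra Kv Ω]
    [IsScalarTower K Kv Ω] (ρ : Gal(Kbar/K) →* AddMonoid.End A) (τ : Kbar →ₐ[K] Ω)
    (F : IntermediateField K Kbar) : Type _ :=
  contH1 ((ρ.comp F.fixingSubgroup.subtype).comp (localToGlobalOver Kv τ F))

/-- The localization map `H¹(F, A) → H¹(F_w, A)`, `F_w = Kv · τ(F)`. -/
noncomputable def localization (Kv : Type u) [Field Kv] [Algebra K Kv] [Algebra Kv Ω]
    [IsScalarTower K Kv Ω] (ρ : Gal(Kbar/K) →* AddMonoid.End A) (τ : Kbar →ₐ[K] Ω)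
    (F : IntermediateField K Kbar) : galH1 ρ F →+ localH1 Kv ρ τ F :=
  contH1Map _ _ (localToGlobalOver Kv τ F) (continuous_localToGlobalOver τ F)
    (AddMonoidHom.id A) (fun _ _ => rfl)

end Local

section Selmer

variable {K : Type u} [Field K] [NumberField K] {Kbar : Type v} [Field Kbar] [Algebra K Kbar]
  [Normal K Kbar] {A : Type w} [AddCommGroup A]

/-- The `S`-imprimitive strict Selmer group of the `Gal(Kbar/K)`-module `A` over `F`: the kernel of
`H¹(F, A) → ∏_{v ∉ S} H¹(F ⊗ K_v, A)`, `v` running over the finite places of `K` outside `S`.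
The places `w` of `F` above `v` are the ones induced by the `K`-embeddings `τ` of `Kbar` in an
algebraic closure of `K_v`, with `F_w = K_v · τ(F)`. So a class lies in the kernel exactly when
it dies in `H¹(F_w, A)` for all `v ∉ S` and all `τ`. -/
noncomputable def imprimitiveSelmer (ρ : Gal(Kbar/K) →* AddMonoid.End A)
    (S : Finset (HeightOneSpectrum (𝓞 K))) (F : IntermediateField K Kbar) :
    AddSubgroup (galH1 ρ F) :=
  ⨅ (v : HeightOneSpectrum (𝓞 K)) (_ : v ∉ S)
    (τ : Kbar →ₐ[K] AlgebraicClosure (v.adicCompletion K)),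
    (localization (v.adicCompletion K) ρ τ F).ker

end Selmer

section Elliptic

instance isElliptic_baseChange {R S : Type*} [CommRing R] [CommRing S] [Algebra R S]
    (V : WeierstrassCurve R) [V.IsElliptic] : (V.baseChange S).IsElliptic :=
  inferInstanceAs (V.map (algebraMap R S)).IsElliptic

lemma infinite_point {K : Type u} [Field K] (W : WeierstrassCurve.Affine K) (Kbar : Type v)
    [Field Kbar] [Algebra K Kbar] [IsAlgClosed Kbar] [W.IsElliptic] :
    Infinite (W.baseChange Kbar).Point := by
  have key : ∀ x : Kbar, ∃ y : Kbar, (W.baseChange Kbar).Nonsingular x y := by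
    intro x
    set V := W.baseChange Kbar
    let q : Polynomial Kbar := Polynomial.C 1 * Polynomial.X ^ 2
      + Polynomial.C (V.a₁ * x + V.a₃) * Polynomial.X
      + Polynomial.C (-(x ^ 3 + V.a₂ * x ^ 2 + V.a₄ * x + V.a₆))
    have hq : q.degree = 2 := Polynomial.degree_quadratic one_ne_zero
    obtain ⟨y, hy⟩ := IsAlgClosed.exists_root q (by rw [hq]; decide)
    refine ⟨y, WeierstrassCurve.Affine.equation_iff_nonsingular.1 ?_⟩
    rw [WeierstrassCurve.Affine.equation_iff]
    simp only [Polynomial.IsRoot, q, Polynomial.eval_add, Polynomial.eval_mul, Polynomial.eval_C,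
      Polynomial.eval_pow, Polynomial.eval_X] at hy
    linear_combination hy
  choose y hy using key
  have : Infinite Kbar := IsAlgClosed.instInfinite
  refine Infinite.of_injective (fun x => WeierstrassCurve.Affine.Point.some x (y x) (hy x)) ?_
  intro a b hab
  simpa using (WeierstrassCurve.Affine.Point.some.inj hab).1

variable {K : Type u} [Field K] (W : WeierstrassCurve.Affine K) (Kbar : Type v) [Field Kbar]
  [Algebra K Kbar] [DecidableEq Kbar]

/-- The action of `Gal(Kbar/K)` on `W(Kbar)`. -/
noncomputable def galPoint : Gal(Kbar/K) →* AddMonoid.End (W.baseChange Kbar).Point where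
  toFun σ := WeierstrassCurve.Affine.Point.map (W' := W) (σ : Kbar →ₐ[K] Kbar)
  map_one' := by
    ext P
    cases P <;> rfl
  map_mul' σ τ := by
    ext P
    cases P <;> rfl

variable {W Kbar} in
/-- At the point `P = (x, y)` the map `φ` is given by `(x, y) ↦ (f/d, g/d)`, and `d(x, y) ≠ 0`. -/
def IsGivenBy (f g d : MvPolynomial (Fin 2) K) (φ : AddMonoid.End (W.baseChange Kbar).Point)
    (P : (W.baseChange Kbar).Point) : Prop :=
  ∃ (x y : Kbar) (h : (W.baseChange Kbar).Nonsingular x y), P = .some x y h ∧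
    MvPolynomial.aeval ![x, y] d ≠ 0 ∧
    ∃ h' : (W.baseChange Kbar).Nonsingular
        (MvPolynomial.aeval ![x, y] f / MvPolynomial.aeval ![x, y] d)
        (MvPolynomial.aeval ![x, y] g / MvPolynomial.aeval ![x, y] d),
      φ P = .some _ _ h'

/-- `φ` is an endomorphism of the elliptic curve `W` defined over `K` (`Kbar` is an algebraic
closure of `K`): it is an endomorphism of the group `W(Kbar)` that is zero or is given, away from
finitely many points, by rational functions with coefficients in `K`. -/
def IsEndomorphism (φ : AddMonoid.End (W.baseChange Kbar).Point) : Prop :=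
  φ = 0 ∨ ∃ f g d : MvPolynomial (Fin 2) K, {P | ¬ IsGivenBy f g d φ P}.Finite

/-- Complex multiplication by the ring of integers of `K`: an isomorphism of `𝓞 K` with the ring
of endomorphisms of `W` over `K`. -/
structure CMByIntegers where
  /-- The endomorphism `[a]` attached to `a`. -/
  toEnd : 𝓞 K →+* AddMonoid.End (W.baseChange Kbar).Point
  injective : Function.Injective toEnd
  mem_range_iff : ∀ φ, φ ∈ toEnd.range ↔ IsEndomorphism W Kbar φ

/-- Endomorphisms over `K` commute with the action of `Gal(Kbar/K)`. -/
lemma IsEndomorphism.commute [IsAlgClosure K Kbar] [W.IsElliptic]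
    {φ : AddMonoid.End (W.baseChange Kbar).Point} (hφ : IsEndomorphism W Kbar φ)
    (σ : Gal(Kbar/K)) (P : (W.baseChange Kbar).Point) :
    φ (galPoint W Kbar σ P) = galPoint W Kbar σ (φ P) := by
  obtain rfl | ⟨f, g, d, hfin⟩ := hφ
  · exact (map_zero (galPoint W Kbar σ)).symm
  have : IsAlgClosed Kbar := IsAlgClosure.isAlgClosed K
  have := infinite_point W Kbar
  have hinj : Function.Injective (galPoint W Kbar σ) :=
    WeierstrassCurve.Affine.Point.map_injective (W' := W) (σ : Kbar →ₐ[K] Kbar)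
  have haev : ∀ (q : MvPolynomial (Fin 2) K) (x y : Kbar),
      MvPolynomial.aeval ![σ x, σ y] q = σ (MvPolynomial.aeval ![x, y] q) := by
    intro q x y
    have h1 : (![σ x, σ y] : Fin 2 → Kbar) = fun i => (σ : Kbar →ₐ[K] Kbar) (![x, y] i) := by
      funext i
      fin_cases i <;> rfl
    rw [h1, ← MvPolynomial.comp_aeval_apply]
    rfl
  let H : AddSubgroup (W.baseChange Kbar).Point :=
    AddMonoidHom.eqLocus ((φ : _ →+ _).comp (galPoint W Kbar σ : _ →+ _))
      ((galPoint W Kbar σ : _ →+ _).comp (φ : _ →+ _))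
  have hH : ((H : Set (W.baseChange Kbar).Point)ᶜ).Finite := by
    refine (hfin.union (hfin.preimage hinj.injOn)).subset ?_
    intro Q hQ
    by_contra hcon
    apply hQ
    simp only [Set.mem_union, Set.mem_ofPred_eq, Set.mem_preimage, not_or, not_not] at hcon
    obtain ⟨⟨x, y, h, rfl, hd, h', hv⟩, ⟨x', y', h₂, he, hd', h₂', hv'⟩⟩ := hcon
    change φ (galPoint W Kbar σ _) = galPoint W Kbar σ (φ _)
    rw [hv', hv]
    obtain ⟨rfl, rfl⟩ : σ x = x' ∧ σ y = y' := WeierstrassCurve.Affine.Point.some.inj he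
    change _ = WeierstrassCurve.Affine.Point.some (σ _) (σ _) _
    simp only [haev, map_div₀]
  by_contra hP
  have hP' : P ∉ H := hP
  have hHinf : (H : Set (W.baseChange Kbar).Point).Infinite := by
    intro hHfin
    exact Set.infinite_univ (by simpa using hHfin.union hH)
  refine (hHinf.image (f := fun Q => P + Q) (fun a _ b _ hab => add_left_cancel hab)) (hH.subset ?_)
  rintro _ ⟨Q, hQ, rfl⟩ hmem
  exact hP' ((H.add_mem_cancel_right hQ).1 hmem)

end Elliptic

namespace CMByIntegers

variable {K : Type u} [Field K] {W : WeierstrassCurve.Affine K} {Kbar : Type v} [Field Kbar]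
  [Algebra K Kbar] [DecidableEq Kbar] (ι : CMByIntegers W Kbar)

/-- `E[𝔭^∞]`: the points of `E(Kbar)` that are killed by some power of the ideal `𝔭`. -/
def primaryTorsion (𝔭 : HeightOneSpectrum (𝓞 K)) : AddSubgroup (W.baseChange Kbar).Point where
  carrier := {P | ∃ n : ℕ, ∀ a ∈ 𝔭.asIdeal ^ n, ι.toEnd a P = 0}
  zero_mem' := ⟨0, fun a _ => map_zero _⟩
  add_mem' := by
    rintro P Q ⟨m, hm⟩ ⟨n, hn⟩
    refine ⟨max m n, fun a ha => ?_⟩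
    rw [map_add, hm a (Ideal.pow_le_pow_right (le_max_left _ _) ha),
      hn a (Ideal.pow_le_pow_right (le_max_right _ _) ha), add_zero]
  neg_mem' := by
    rintro P ⟨m, hm⟩
    exact ⟨m, fun a ha => by rw [map_neg, hm a ha, neg_zero]⟩

section

variable [IsAlgClosure K Kbar] [W.IsElliptic]

lemma galPoint_mem (𝔭 : HeightOneSpectrum (𝓞 K)) (σ : Gal(Kbar/K))
    {P : (W.baseChange Kbar).Point} (hP : P ∈ ι.primaryTorsion 𝔭) :
    galPoint W Kbar σ P ∈ ι.primaryTorsion 𝔭 := by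
  obtain ⟨n, hn⟩ := hP
  refine ⟨n, fun a ha => ?_⟩
  rw [((ι.mem_range_iff _).1 ⟨a, rfl⟩).commute, hn a ha, map_zero]

/-- The action of `Gal(Kbar/K)` on `E[𝔭^∞]`. -/
noncomputable def galoisRep (𝔭 : HeightOneSpectrum (𝓞 K)) :
    Gal(Kbar/K) →* AddMonoid.End (ι.primaryTorsion 𝔭) where
  toFun σ := ((galPoint W Kbar σ : _ →+ _).comp (ι.primaryTorsion 𝔭).subtype).codRestrict _
    (fun P => ι.galPoint_mem 𝔭 σ P.2)
  map_one' := by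
    ext P
    exact congrArg (fun u : AddMonoid.End (W.baseChange Kbar).Point => u P) (map_one (galPoint W Kbar))
  map_mul' σ τ := by
    ext P
    exact congrArg (fun u : AddMonoid.End (W.baseChange Kbar).Point => u P)
      (map_mul (galPoint W Kbar) σ τ)

end

/-- The field `L(E[𝔭^∞])`, generated over `L` by the coordinates of the points of `E[𝔭^∞]`. -/
def divisionField (𝔭 : HeightOneSpectrum (𝓞 K)) (L : IntermediateField K Kbar) :
    IntermediateField K Kbar :=
  L ⊔ IntermediateField.adjoin K {z | ∃ (x y : Kbar) (h : (W.baseChange Kbar).Nonsingular x y),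
    .some x y h ∈ ι.primaryTorsion 𝔭 ∧ (z = x ∨ z = y)}

lemma le_divisionField (𝔭 : HeightOneSpectrum (𝓞 K)) (L : IntermediateField K Kbar) :
    L ≤ ι.divisionField 𝔭 L := le_sup_left

instance isGalois_divisionField [IsAlgClosure K Kbar] [W.IsElliptic] [IsGalois K Kbar]
    (𝔭 : HeightOneSpectrum (𝓞 K)) (L : IntermediateField K Kbar) [IsGalois K L] :
    IsGalois K (ι.divisionField 𝔭 L) := by
  have hN : Normal K (ι.divisionField 𝔭 L) := by
    rw [IntermediateField.normal_iff_forall_map_le']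
    intro σ
    rw [divisionField, IntermediateField.map_sup]
    refine sup_le_sup (IntermediateField.normal_iff_forall_map_le'.1 inferInstance σ) ?_
    rw [IntermediateField.adjoin_map]
    refine IntermediateField.adjoin.mono _ _ _ ?_
    rintro _ ⟨z, ⟨x, y, h, hmem, hz⟩, rfl⟩
    refine ⟨σ x, σ y, _, ι.galPoint_mem 𝔭 σ hmem, ?_⟩
    rcases hz with rfl | rfl
    · exact Or.inl rfl
    · exact Or.inr rfl
  exact {}

end CMByIntegers

/-- The subgroup `Sel_S(F', A)^{Gal(F'/L)}` of the elements of the Selmer group over `F'` that are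
fixed by `Gal(F'/L)`, where `F'/K` is Galois and `L ≤ F'`; `Gal(F'/L)` acts through lifts to
`Gal(Kbar/L)`. -/
noncomputable def selmerInvariants {K : Type u} [Field K] [NumberField K] {Kbar : Type v}
    [Field Kbar] [Algebra K Kbar] [IsGalois K Kbar] {A : Type w} [AddCommGroup A]
    (ρ : Gal(Kbar/K) →* AddMonoid.End A) (S : Finset (HeightOneSpectrum (𝓞 K)))
    (L F' : IntermediateField K Kbar) [IsGalois K F'] : AddSubgroup (galH1 ρ F') :=
  imprimitiveSelmer ρ S F' ⊓ ⨅ σ ∈ L.fixingSubgroup, (galConj ρ F' σ - AddMonoidHom.id _).ker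

/-! Write `A = E[𝔭^∞]`, `Γ = Gal(Kbar/L)`, and let `N` be the kernel of `Γ` on `A`. Since `L^𝔭` is
generated by the coordinates of `A`, one has `N = Gal(Kbar/L^𝔭)`. By inflation-restriction, the
kernel of `H¹(L, A) → H¹(L^𝔭, A)` is `H¹(Γ/N, A)`, and the obstruction to reaching every invariant
class lies in `H²(Γ/N, A)`. Both vanish because `A` is zero or `ℚ_p/ℤ_p`: then `Γ/N` is a closed
subgroup of `ℤ_p^×`, which is procyclic for odd `p`, and `γ - 1` is surjective on `A` for a suitable
`γ` unless the action is trivial, when there is nothing to prove. The argument is carried out on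
cocycles, without `H²`: `mem_contB1_of_forall_mem_ker` gives injectivity and
`exists_cocycle_extension` surjectivity. The vanishing applies equally to the local Galois groups,
so a class over `L` is locally trivial at a place exactly when its restriction to `L^𝔭` is. Hence
the Selmer conditions correspond (`localization_galRes_eq_zero_iff`).

It remains to see that `A` is quasi-cyclic, the point being that `A[p]` has at most `p` elements. On
`x`-coordinates, `[a]` is a rational function. Its degree satisfies half of the parallelogram law
(`IsXMap.ratDegree_add_le`), hence grows at most quadratically on the lattice `𝓞 K`, that is, at
most like a constant times `N(a)`. So `#ker [a] ≤ C * N(a)`, and applying this to the powers of `a`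
removes the constant (`card_ker_le`). If `𝔭 ^ m = (α)`, then `A[p ^ m]` lies in `ker [α]`, so `#A[p]
^ m ≤ #A[p ^ m] ≤ p ^ m`. Divisibility follows from surjectivity of `[p]` and projection to the
`𝔭`-part. -/

/-- An abelian group is `p`-quasi-cyclic if it is `p`-primary, `p`-divisible and its `p`-torsion is
cyclic. It is then zero or isomorphic to `ℚ_p/ℤ_p`. -/
structure IsQuasiCyclic (p : ℕ) (A : Type*) [AddCommGroup A] : Prop where
  exists_pow_smul_eq_zero : ∀ a : A, ∃ n : ℕ, p ^ n • a = 0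
  exists_smul_eq : ∀ a : A, ∃ b : A, p • b = a
  exists_eq_smul : ∀ x y : A, p • x = 0 → x ≠ 0 → p • y = 0 → ∃ n : ℕ, y = n • x

/-! ### Quasi-cyclic groups and their endomorphisms -/

namespace IsQuasiCyclic

variable {p : ℕ} {A : Type*} [AddCommGroup A]

lemma exists_pow_smul_eq (hA : IsQuasiCyclic p A) (m : ℕ) (a : A) : ∃ b : A, p ^ m • b = a := by
  induction m generalizing a with
  | zero => exact ⟨a, by simp⟩
  | succ m ih =>
    obtain ⟨b, rfl⟩ := hA.exists_smul_eq a
    obtain ⟨c, rfl⟩ := ih b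
    exact ⟨c, by rw [pow_succ', mul_smul]⟩

/-- Multiplication by `p` lowers the level by one: if `p • y = n • p • x`, then `y - n • x` is
`p`-torsion, hence a multiple of `p ^ (m + 1) • x`. Thus an element of maximal order generates the
torsion at its level. -/
lemma mem_multiples (hA : IsQuasiCyclic p A) (m : ℕ) {x y : A} (hx : p ^ m • x ≠ 0)
    (hx' : p ^ (m + 1) • x = 0) (hy : p ^ (m + 1) • y = 0) : ∃ n : ℕ, y = n • x := by
  induction m generalizing x y with
  | zero => exact hA.exists_eq_smul x y (by simpa using hx') (by simpa using hx) (by simpa using hy)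
  | succ m ih =>
    have e (z : A) (j : ℕ) : p ^ j • p • z = p ^ (j + 1) • z := by rw [pow_succ, mul_smul]
    obtain ⟨n, hn⟩ := ih (x := p • x) (y := p • y) (by rwa [e]) (by rwa [e]) (by rwa [e])
    have h0 : p • (p ^ (m + 1) • x) = 0 := by rwa [← mul_smul, ← pow_succ']
    have hneg : p • (-(n • x)) = -(p • y) := by rw [smul_neg, hn, smul_comm]
    obtain ⟨k, hk⟩ := hA.exists_eq_smul _ (y + -(n • x)) h0 hx (by rw [smul_add, hneg]; abel)
    refine ⟨n + k * p ^ (m + 1), ?_⟩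
    rw [add_smul, mul_smul, ← hk]
    abel

lemma pow_smul_eq_zero_of_le {a : A} {m n : ℕ} (h : m ≤ n) (ha : p ^ m • a = 0) :
    p ^ n • a = 0 := by
  obtain ⟨k, rfl⟩ := Nat.exists_eq_add_of_le h
  rw [add_comm, pow_add, mul_smul, ha, smul_zero]

lemma exists_exact_order {a : A} (ha : a ≠ 0) (h : ∃ n, p ^ n • a = 0) :
    ∃ m, p ^ m • a ≠ 0 ∧ p ^ (m + 1) • a = 0 := by
  classical
  have h1 := Nat.find_spec h
  rcases hm : Nat.find h with _ | m
  · rw [hm] at h1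
    exact absurd (by simpa using h1) ha
  · rw [hm] at h1
    exact ⟨m, Nat.find_min h (by omega), h1⟩

/-- Generators of the `p ^ (m + 1)`-torsion. -/
lemma exists_generator (hA : IsQuasiCyclic p A) [Nontrivial A] (m : ℕ) :
    ∃ e : A, p ^ m • e ≠ 0 ∧ p ^ (m + 1) • e = 0 := by
  obtain ⟨a, ha⟩ := exists_ne (0 : A)
  obtain ⟨j, hj, hj'⟩ := exists_exact_order ha (hA.exists_pow_smul_eq_zero a)
  obtain ⟨e, he⟩ := hA.exists_pow_smul_eq m (p ^ j • a)
  refine ⟨e, by rwa [he], ?_⟩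
  rw [pow_succ', mul_smul, he, ← mul_smul, ← pow_succ', hj']

/-- An endomorphism of a finite cyclic group is determined by the image of a generator. This is the
finite-level form of `End (ℚ_p/ℤ_p) = ℤ_p`. -/
lemma exists_forall_eq_smul (hA : IsQuasiCyclic p A) (u : AddMonoid.End A) (m : ℕ) :
    ∃ n : ℕ, ∀ a, p ^ m • a = 0 → u a = n • a := by
  cases subsingleton_or_nontrivial A
  · exact ⟨0, fun a _ => Subsingleton.elim _ _⟩
  obtain ⟨e, he, he'⟩ := hA.exists_generator m
  obtain ⟨n, hn⟩ := hA.mem_multiples m he he' (y := u e) (by rw [← map_nsmul, he', map_zero])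
  refine ⟨n, fun a ha => ?_⟩
  obtain ⟨k, rfl⟩ := hA.mem_multiples m he he' (y := a) (pow_smul_eq_zero_of_le m.le_succ ha)
  rw [map_nsmul, hn, smul_comm]

lemma end_comm (hA : IsQuasiCyclic p A) (u v : AddMonoid.End A) (a : A) : u (v a) = v (u a) := by
  obtain ⟨m, hm⟩ := hA.exists_pow_smul_eq_zero a
  obtain ⟨n, hn⟩ := hA.exists_forall_eq_smul u m
  obtain ⟨n', hn'⟩ := hA.exists_forall_eq_smul v m
  rw [hn a hm, hn' a hm, map_nsmul, map_nsmul, hn a hm, hn' a hm, smul_comm]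

/-- If `u` does not kill the `p ^ (k + 1)`-torsion, its kernel lies in the `p ^ k`-torsion. -/
lemma pow_smul_eq_zero_of_apply_eq_zero (hA : IsQuasiCyclic p A) {u : AddMonoid.End A} {k : ℕ}
    (hu : ∃ a, p ^ (k + 1) • a = 0 ∧ u a ≠ 0) {a : A} (ha : u a = 0) : p ^ k • a = 0 := by
  obtain ⟨b, hb, hub⟩ := hu
  by_contra hne
  obtain ⟨m, hm, hm'⟩ := exists_exact_order (p := p) (a := a) (by rintro rfl; simp at hne)
    (hA.exists_pow_smul_eq_zero a)
  have hkm : k ≤ m := by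
    by_contra! h
    exact hne (pow_smul_eq_zero_of_le h hm')
  obtain ⟨n, rfl⟩ := hA.mem_multiples m hm hm' (y := b) (pow_smul_eq_zero_of_le (by omega) hb)
  exact hub (by rw [map_nsmul, ha, smul_zero])

/-- The kernel of `u` lies in the `p ^ k`-torsion, so an element of order `p ^ (m + k + 1)` is sent
to one of order greater than `p ^ m`, whose multiples exhaust the `p ^ m`-torsion. -/
lemma surjective_of_apply_ne_zero (hA : IsQuasiCyclic p A) {u : AddMonoid.End A} {k : ℕ}
    (hu : ∃ a, p ^ (k + 1) • a = 0 ∧ u a ≠ 0) : Function.Surjective u := by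
  intro b
  by_cases hb : b = 0
  · exact ⟨0, by rw [map_zero, hb]⟩
  have : Nontrivial A := ⟨b, 0, hb⟩
  obtain ⟨m, hm⟩ := hA.exists_pow_smul_eq_zero b
  obtain ⟨e, he, -⟩ := hA.exists_generator (m + k)
  have hue : p ^ m • u e ≠ 0 := by
    intro h
    rw [← map_nsmul] at h
    have := hA.pow_smul_eq_zero_of_apply_eq_zero hu h
    rw [← mul_smul, ← pow_add, add_comm k m] at this
    exact he this
  obtain ⟨j, hj, hj'⟩ := exists_exact_order (p := p) (a := u e)
    (by intro h; simp [h] at hue) (hA.exists_pow_smul_eq_zero _)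
  have hmj : m ≤ j := by
    by_contra! h
    exact hue (pow_smul_eq_zero_of_le h hj')
  obtain ⟨n, rfl⟩ := hA.mem_multiples j hj hj' (pow_smul_eq_zero_of_le (hmj.trans j.le_succ) hm)
  exact ⟨n • e, map_nsmul _ _ _⟩

end IsQuasiCyclic

/-! ### Topological generators of `1 + p ^ k ℤ_p` -/

/-- For `p` odd, `k ≥ 1` and `c` exactly divisible by `p ^ k`, the powers of `1 + c` are dense in
`1 + p ^ k ℤ_p`. -/
lemma exists_pow_modEq {p : ℕ} (hp : p.Prime) (hp2 : p ≠ 2) {k : ℕ} (hk : 1 ≤ k) {c : ℤ}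
    (hc : (p : ℤ) ^ k ∣ c) (hc' : ¬ (p : ℤ) ^ (k + 1) ∣ c) {d : ℤ} (hd : (p : ℤ) ^ k ∣ d) (m : ℕ) :
    ∃ i : ℕ, (p : ℤ) ^ (k + m) ∣ (1 + c) ^ i - (1 + d) := by
  have hpp : Prime (p : ℤ) := Nat.prime_iff_prime_int.1 hp
  have hpc : (p : ℤ) ∣ c := (dvd_pow_self _ (by omega)).trans hc
  induction m with
  | zero => exact ⟨0, by simpa using hd⟩
  | succ m ih =>
    obtain ⟨i, hi⟩ := ih
    -- Lifting the exponent: `(1 + c) ^ p ^ m = 1 + p ^ (k + m) * t` with `t` prime to `p`, so its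
    -- powers can correct the next `p`-adic digit.
    have hval : emultiplicity (p : ℤ) ((1 + c) ^ (p ^ m) - 1) = (k + m : ℕ) := by
      have h1 : emultiplicity (p : ℤ) c = k := emultiplicity_eq_coe.2 ⟨hc, hc'⟩
      have h2 := Int.emultiplicity_pow_sub_pow (p := p) hp (hp.odd_of_ne_two hp2) (x := 1 + c) (y := 1)
        (by simpa using hpc) (by
          intro h
          exact hpp.not_isUnit (isUnit_of_dvd_one ((dvd_add_left hpc).1 h))) (p ^ m)
      rw [one_pow, add_sub_cancel_left, h1] at h2
      rw [h2, Nat.Prime.emultiplicity_pow_self hp]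
      push_cast
      rfl
    obtain ⟨⟨t, ht⟩, ht'⟩ := emultiplicity_eq_coe.1 hval
    obtain ⟨r, hr⟩ := hi
    have htp : ¬ (p : ℤ) ∣ t := fun h => ht' (by
      rw [ht, pow_succ]; exact mul_dvd_mul_left _ h)
    have hcop : IsCoprime (p : ℤ) t := (Prime.coprime_iff_not_dvd hpp).2 htp
    obtain ⟨a, b, hab⟩ := hcop
    -- choose `j ≡ - r * b` modulo `p`
    obtain ⟨j, hj⟩ : ∃ j : ℕ, (p : ℤ) ∣ r + j * t := by
      refine ⟨((-r * b) % p).toNat, ?_⟩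
      rw [Int.toNat_of_nonneg (Int.emod_nonneg _ (by exact_mod_cast hp.ne_zero)), Int.emod_def]
      exact ⟨r * a - (-r * b / p) * t, by linear_combination (-r) * hab⟩
    have hpow : ∀ j : ℕ, (p : ℤ) ^ (k + m + 1) ∣
        ((1 + c) ^ (p ^ m)) ^ j - (1 + p ^ (k + m) * (j * t)) := by
      intro j
      induction j with
      | zero => simp
      | succ j ihj =>
        obtain ⟨s, hs⟩ := ihj
        have hX : (1 + c) ^ (p ^ m) = 1 + p ^ (k + m) * t := by linear_combination ht
        obtain ⟨l, hl⟩ : (p : ℤ) ^ (k + m + 1) ∣ p ^ (k + m) * p ^ (k + m) := by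
          rw [pow_succ]; exact mul_dvd_mul_left _ (dvd_pow_self _ (by omega))
        refine ⟨s * (1 + p ^ (k + m) * t) + l * (j * t * t), ?_⟩
        rw [hX] at hs
        rw [pow_succ, hX]
        push_cast
        linear_combination (1 + (p : ℤ) ^ (k + m) * t) * hs + (j * t * t) * hl
    refine ⟨i + p ^ m * j, ?_⟩
    obtain ⟨s, hs⟩ := hpow j
    -- The factor `(1 + c) ^ i` is `1` modulo `p`, so it does not affect the digit being corrected.
    obtain ⟨l, hl⟩ : (p : ℤ) ^ (k + m + 1) ∣ p ^ (k + m) * ((1 + c) ^ i - 1) := by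
      rw [pow_succ]
      refine mul_dvd_mul_left _ ?_
      have : (1 + c - 1) ∣ (1 + c) ^ i - 1 ^ i := sub_dvd_pow_sub_pow _ _ _
      rw [one_pow, add_sub_cancel_left] at this
      exact hpc.trans this
    obtain ⟨q, hq⟩ := hj
    refine ⟨(1 + c) ^ i * s + q + l * (j * t), ?_⟩
    rw [pow_add, pow_mul, ← add_assoc k m 1]
    linear_combination (1 + c) ^ i * hs + hr + (p : ℤ) ^ (k + m) * hq + (j * t) * hl

/-! ### Group actions on quasi-cyclic modules and vanishing of `H¹` of the image -/

section QuasiCyclicAction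

open scoped Topology

variable {p : ℕ} {Γ A : Type*} [Group Γ] [AddCommGroup A]

/-- The subgroup of the elements acting trivially on the `p ^ m`-torsion. -/
def torsionKer (p : ℕ) (ρ : Γ →* AddMonoid.End A) (m : ℕ) : Subgroup Γ where
  carrier := {g | ∀ a, p ^ m • a = 0 → ρ g a = a}
  one_mem' := fun a _ => by rw [map_one]; rfl
  mul_mem' := by
    intro g h hg hh a ha
    rw [map_mul]
    change ρ g (ρ h a) = a
    rw [hh a ha, hg a ha]
  inv_mem' := by
    intro g hg a ha
    conv_lhs => rw [← hg a ha]
    change (ρ g⁻¹ * ρ g) a = a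
    rw [← map_mul, inv_mul_cancel, map_one]
    rfl

lemma mem_torsionKer {ρ : Γ →* AddMonoid.End A} {m : ℕ} {g : Γ} :
    g ∈ torsionKer p ρ m ↔ ∀ a, p ^ m • a = 0 → ρ g a = a := Iff.rfl

lemma mem_ker_iff_forall_apply {ρ : Γ →* AddMonoid.End A} {g : Γ} :
    g ∈ ρ.ker ↔ ∀ a, ρ g a = a := by
  rw [MonoidHom.mem_ker]
  exact ⟨fun h a => by rw [h]; rfl, fun h => AddMonoidHom.ext h⟩

lemma End.mul_apply' (ρ : Γ →* AddMonoid.End A) (g h : Γ) (a : A) : ρ (g * h) a = ρ g (ρ h a) := by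
  rw [map_mul]; rfl

instance torsionKer_normal (p : ℕ) (ρ : Γ →* AddMonoid.End A) (m : ℕ) : (torsionKer p ρ m).Normal := by
  refine ⟨fun n hn g a ha => ?_⟩
  rw [End.mul_apply', End.mul_apply', hn _ (by rw [← map_nsmul, ha, map_zero]), ← End.mul_apply',
    mul_inv_cancel, map_one]
  rfl

lemma ker_le_torsionKer (p : ℕ) (ρ : Γ →* AddMonoid.End A) (m : ℕ) : ρ.ker ≤ torsionKer p ρ m :=
  fun _ hg a _ => mem_ker_iff_forall_apply.1 hg a

lemma torsionKer_anti (ρ : Γ →* AddMonoid.End A) : Antitone (torsionKer p ρ) :=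
  fun _ _ h _ hg a ha => hg a (IsQuasiCyclic.pow_smul_eq_zero_of_le h ha)

lemma apply_pow_of_eq_nsmul {ρ : Γ →* AddMonoid.End A} {g : Γ} {n m : ℕ}
    (h : ∀ a, p ^ m • a = 0 → ρ g a = n • a) (i : ℕ) {a : A} (ha : p ^ m • a = 0) :
    ρ (g ^ i) a = n ^ i • a := by
  induction i with
  | zero => rw [pow_zero, map_one, pow_zero, one_smul]; rfl
  | succ i ih =>
    rw [pow_succ', End.mul_apply', ih, map_nsmul, h a ha, pow_succ, mul_smul]

variable {ρ : Γ →* AddMonoid.End A}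

lemma exists_first_nontrivial (hA : IsQuasiCyclic p A) (h : ∃ g, g ∉ ρ.ker) :
    ∃ (k : ℕ) (g : Γ), g ∉ torsionKer p ρ (k + 1) ∧ ∀ h, h ∈ torsionKer p ρ k := by
  classical
  obtain ⟨g, hg⟩ := h
  have hex : ∃ m, ∃ g, g ∉ torsionKer p ρ m := by
    rw [mem_ker_iff_forall_apply] at hg
    push Not at hg
    obtain ⟨a, ha⟩ := hg
    obtain ⟨m, hm⟩ := hA.exists_pow_smul_eq_zero a
    exact ⟨m, g, fun h => ha (h a hm)⟩
  have hs := Nat.find_spec hex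
  rcases hm : Nat.find hex with _ | k
  · rw [hm] at hs
    obtain ⟨g, hg⟩ := hs
    refine absurd ?_ hg
    intro a ha
    rw [pow_zero, one_smul] at ha
    rw [ha, map_zero]
  · rw [hm] at hs
    obtain ⟨g, hg⟩ := hs
    refine ⟨k, g, hg, fun h => ?_⟩
    have := Nat.find_min hex (m := k) (by omega)
    push Not at this
    exact this h

lemma pow_dvd_of_zsmul_eq_zero (hp : p.Prime) {e : A} {j : ℕ} (he : p ^ j • e ≠ 0)
    (he' : p ^ (j + 1) • e = 0) {n : ℤ} (hn : n • e = 0) : (p : ℤ) ^ (j + 1) ∣ n := by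
  have := Fact.mk hp
  have h := addOrderOf_eq_prime_pow he he'
  rw [← addOrderOf_dvd_iff_zsmul_eq_zero, h] at hn
  exact_mod_cast hn

/-- If `Γ` acts trivially on the `p ^ k`-torsion and `g` acts nontrivially on the
`p ^ (k + 1)`-torsion, then elements of `Γ` act on the torsion of large order through integers
congruent to `1` modulo `p ^ k`, and for `g` the congruence does not hold modulo `p ^ (k + 1)`. -/
lemma exists_eq_nsmul_and_dvd (hA : IsQuasiCyclic p A) (hp : p.Prime) {k : ℕ}
    (htriv : ∀ h, h ∈ torsionKer p ρ k) [Nontrivial A] (m : ℕ) (h : Γ) :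
    ∃ n : ℕ, (∀ a, p ^ (k + m) • a = 0 → ρ h a = n • a) ∧ (p : ℤ) ^ k ∣ n - 1 ∧
      ∀ j ≤ k + m, ((p : ℤ) ^ j ∣ n - 1 ↔ h ∈ torsionKer p ρ j) := by
  obtain ⟨n, hn⟩ := hA.exists_forall_eq_smul (ρ h) (k + m)
  have key : ∀ j ≤ k + m, ((p : ℤ) ^ j ∣ n - 1 ↔ h ∈ torsionKer p ρ j) := by
    intro j hj
    have hn' : ∀ a, p ^ j • a = 0 → ρ h a - a = ((n : ℤ) - 1) • a := fun a ha => by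
      rw [hn a (IsQuasiCyclic.pow_smul_eq_zero_of_le hj ha), sub_smul, one_smul, natCast_zsmul]
    constructor
    · rintro ⟨c, hc⟩ a ha
      rw [← sub_eq_zero, hn' a ha, hc, mul_comm, mul_smul, ← Nat.cast_pow, natCast_zsmul, ha,
        smul_zero]
    · intro hh
      obtain _ | j := j
      · simp
      obtain ⟨e, he, he'⟩ := hA.exists_generator j
      refine pow_dvd_of_zsmul_eq_zero hp he he' ?_
      rw [← hn' e he', hh e he', sub_self]
  exact ⟨n, hn, (key k (by omega)).2 (htriv h), key⟩

/-- The powers of `g` approximate every element of `Γ`. -/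
lemma exists_pow_apply_eq (hA : IsQuasiCyclic p A) (hp : p.Prime) (hp2 : p ≠ 2) {k : ℕ} (hk : 1 ≤ k)
    {g : Γ} (hg : g ∉ torsionKer p ρ (k + 1)) (htriv : ∀ h, h ∈ torsionKer p ρ k) (m : ℕ) (h : Γ) :
    ∃ i : ℕ, (g ^ i)⁻¹ * h ∈ torsionKer p ρ m := by
  cases subsingleton_or_nontrivial A
  · exact ⟨0, fun a _ => Subsingleton.elim _ _⟩
  -- Level `k + (m + 1)` rather than `k + m`: the criterion at `k + 1` is needed for `g` even when
  -- `m = 0`.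
  obtain ⟨n, hn, hnk, hn'⟩ := exists_eq_nsmul_and_dvd hA hp htriv (m + 1) g
  obtain ⟨l, hl, hlk, hl'⟩ := exists_eq_nsmul_and_dvd hA hp htriv (m + 1) h
  obtain ⟨i, hi⟩ := exists_pow_modEq hp hp2 hk hnk (fun hd => hg ((hn' _ (by omega)).1 hd)) hlk (m + 1)
  refine ⟨i, fun a ha => ?_⟩
  have ha' : p ^ (k + (m + 1)) • a = 0 := IsQuasiCyclic.pow_smul_eq_zero_of_le (by omega) ha
  have : ρ (g ^ i) a = ρ h a := by
    rw [apply_pow_of_eq_nsmul hn i ha', hl a ha', ← sub_eq_zero, ← natCast_zsmul, ← natCast_zsmul,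
      ← sub_smul]
    obtain ⟨c, hc⟩ := hi
    rw [add_sub_cancel, add_sub_cancel] at hc
    rw [Nat.cast_pow, hc, mul_comm, mul_smul, ← Nat.cast_pow, natCast_zsmul, ha', smul_zero]
  rw [End.mul_apply', ← this, ← End.mul_apply', inv_mul_cancel, map_one]
  rfl

/-- If `g` acts as the integer `n`, then `n - 1` has valuation exactly `k`, and lifting the exponent
gives `n ^ t - 1` valuation `k + v_p(t)`. -/
lemma pow_dvd_of_pow_mem_torsionKer (hA : IsQuasiCyclic p A) (hp : p.Prime) (hp2 : p ≠ 2) {k : ℕ}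
    (hk : 1 ≤ k) {g : Γ} (hg : g ∉ torsionKer p ρ (k + 1)) (htriv : ∀ h, h ∈ torsionKer p ρ k)
    {j t : ℕ} (ht : g ^ t ∈ torsionKer p ρ (k + j)) : p ^ j ∣ t := by
  have : Nontrivial A := by
    by_contra h
    rw [not_nontrivial_iff_subsingleton] at h
    exact hg fun a _ => Subsingleton.elim _ _
  obtain _ | j := j
  · simp
  obtain ⟨n, hn, hnk, hn'⟩ := exists_eq_nsmul_and_dvd hA hp htriv (j + 1) g
  have hd : (p : ℤ) ^ (k + (j + 1)) ∣ (n : ℤ) ^ t - 1 := by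
    obtain ⟨e, he, he'⟩ := hA.exists_generator (k + j)
    refine pow_dvd_of_zsmul_eq_zero hp he he' ?_
    rw [sub_smul, one_smul, ← Nat.cast_pow, natCast_zsmul, ← apply_pow_of_eq_nsmul hn t he', ht e he',
      sub_self]
  have hpp : Prime (p : ℤ) := Nat.prime_iff_prime_int.1 hp
  have hpc : (p : ℤ) ∣ n - 1 := (dvd_pow_self _ (by omega)).trans hnk
  have h1 : emultiplicity (p : ℤ) ((n : ℤ) - 1) = k :=
    emultiplicity_eq_coe.2 ⟨hnk, fun hd => hg ((hn' _ (by omega)).1 hd)⟩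
  have h2 := Int.emultiplicity_pow_sub_pow (p := p) hp (hp.odd_of_ne_two hp2) (x := n) (y := 1) hpc
    (by
      intro h
      exact hpp.not_isUnit (isUnit_of_dvd_one ((dvd_sub_right h).1 hpc))) t
  rw [one_pow, h1] at h2
  rw [pow_dvd_iff_le_emultiplicity] at hd ⊢
  rw [h2] at hd
  push_cast at hd
  exact (ENat.add_le_add_iff_left (ENat.natCast_ne_top k)).1 hd

lemma sub_one_apply (g : Γ) (a : A) : (ρ g - 1 : AddMonoid.End A) a = ρ g a - a := rfl

lemma exists_sub_one_apply_ne_zero {k : ℕ} {g : Γ} (hg : g ∉ torsionKer p ρ (k + 1)) :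
    ∃ a, p ^ (k + 1) • a = 0 ∧ (ρ g - 1 : AddMonoid.End A) a ≠ 0 := by
  rw [mem_torsionKer] at hg
  push Not at hg
  obtain ⟨a, ha, hne⟩ := hg
  exact ⟨a, ha, by rwa [sub_one_apply, sub_ne_zero]⟩

lemma cocycle_one {f : Γ → A} (hf : ∀ g h, f (g * h) = f g + ρ g (f h)) : f 1 = 0 := by
  have := hf 1 1
  rw [mul_one, map_one] at this
  exact left_eq_add.1 this

/-- The image of the action is abelian because all endomorphisms of a quasi-cyclic group commute. -/
lemma commutator_mem_ker (hA : IsQuasiCyclic p A) (g h : Γ) : g * h * g⁻¹ * h⁻¹ ∈ ρ.ker := by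
  rw [mem_ker_iff_forall_apply]
  intro a
  rw [mul_assoc, mul_assoc, End.mul_apply', End.mul_apply', hA.end_comm (ρ g) (ρ h), ← End.mul_apply',
    ← End.mul_apply', show h * g * (g⁻¹ * h⁻¹) = 1 by group, map_one]
  rfl

section Topology

variable [TopologicalSpace Γ] [IsTopologicalGroup Γ]

lemma isOpen_torsionKer (hA : IsQuasiCyclic p A) (hρ : ∀ a, IsOpen {g | ρ g a = a}) (m : ℕ) :
    IsOpen (torsionKer p ρ m : Set Γ) := by
  cases subsingleton_or_nontrivial A
  · convert isOpen_univ
    exact Set.eq_univ_of_forall fun g a _ => Subsingleton.elim _ _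
  -- A generator of the `p ^ (m + 1)`-torsion has stabilizer `torsionKer p ρ (m + 1)`, an open
  -- subgroup contained in the one at level `m`.
  obtain ⟨e, he, he'⟩ := hA.exists_generator m
  refine Subgroup.isOpen_mono (H₁ := (torsionKer p ρ (m + 1))) (torsionKer_anti _ m.le_succ) ?_
  convert hρ e using 1
  ext g
  refine ⟨fun h => h e he', fun h a ha => ?_⟩
  obtain ⟨n, rfl⟩ := hA.mem_multiples m he he' ha
  rw [map_nsmul, show ρ g e = e from h]

/-- Compactness: the subgroups `torsionKer p ρ m` are closed and decreasing, and their intersection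
is `ρ.ker` because `A` is `p`-primary. -/
lemma exists_torsionKer_subset [CompactSpace Γ] (hA : IsQuasiCyclic p A)
    (hρ : ∀ a, IsOpen {g | ρ g a = a}) {U : Set Γ} (hU : IsOpen U) (hker : (ρ.ker : Set Γ) ⊆ U) :
    ∃ m, (torsionKer p ρ m : Set Γ) ⊆ U := by
  have hcl m := (torsionKer p ρ m).isClosed_of_isOpen (isOpen_torsionKer hA hρ m)
  refine exists_subset_nhds_of_isCompact' (V := fun m => (torsionKer p ρ m : Set Γ))
    (directed_of_isDirected_le fun _ _ h => torsionKer_anti ρ h) (fun m => (hcl m).isCompact) hcl ?_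
  intro g hg
  refine hU.mem_nhds (hker (mem_ker_iff_forall_apply.2 fun a => ?_))
  obtain ⟨m, hm⟩ := hA.exists_pow_smul_eq_zero a
  exact Set.mem_iInter.1 hg m a hm

/-- A continuous cocycle of a compact group with values in a `p`-quasi-cyclic module, `p` odd, is a
coboundary if it vanishes on the kernel of the action. -/
theorem mem_contB1_of_forall_mem_ker [CompactSpace Γ] (hA : IsQuasiCyclic p A) (hp : p.Prime)
    (hp2 : p ≠ 2) (hρ : ∀ a, IsOpen {g | ρ g a = a}) {f : Γ → A} (hf : f ∈ contZ1 ρ)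
    (hker : ∀ n ∈ ρ.ker, f n = 0) : f ∈ contB1 ρ := by
  by_cases htriv : ∃ g, g ∉ ρ.ker
  swap
  · push Not at htriv
    exact ⟨0, fun g => by rw [hker g (htriv g), map_zero, sub_zero]⟩
  obtain ⟨k, g, hg, htriv⟩ := exists_first_nontrivial hA htriv
  have hu := exists_sub_one_apply_ne_zero hg
  -- Since `ρ g - 1` is surjective, subtracting a coboundary makes the cocycle vanish at `g`; the
  -- normalized cocycle, called `F` below, has to be shown to be zero.
  obtain ⟨a, ha⟩ := hA.surjective_of_apply_ne_zero hu (f g)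
  obtain ⟨hlc, hmul⟩ : (fun h => f h - (ρ h a - a)) ∈ contZ1 ρ ∧ True := by
    refine ⟨⟨?_, ?_⟩, trivial⟩
    · refine hf.1.sub (IsLocallyConstant.sub ?_ (IsLocallyConstant.const a))
      rw [IsLocallyConstant.iff_eventually_eq]
      intro x
      have : Filter.Tendsto (fun y => x⁻¹ * y) (𝓝 x) (𝓝 1) := by
        have h1 : Continuous fun y : Γ => x⁻¹ * y := by fun_prop
        simpa using h1.tendsto x
      filter_upwards [this ((hρ a).mem_nhds (x := 1) (by
        change ρ 1 a = a
        rw [map_one]; rfl))] with y hy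
      have hy' : ρ (x⁻¹ * y) a = a := hy
      have h2 : ρ y a = ρ x (ρ (x⁻¹ * y) a) := by rw [← End.mul_apply', mul_inv_cancel_left]
      rw [h2, hy']
    · intro x y
      simp only [hf.2, map_sub, End.mul_apply']
      abel
  refine ⟨a, fun h => sub_eq_zero.1 ?_⟩
  obtain ⟨F, hF⟩ : ∃ F : Γ → A, ∀ h, F h = f h - (ρ h a - a) := ⟨_, fun _ => rfl⟩
  obtain ⟨hlc, hmul⟩ := hlc
  simp only [← hF] at hlc hmul ⊢
  have hker' : ∀ n ∈ ρ.ker, F n = 0 := fun n hn => by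
    rw [hF, hker n hn, mem_ker_iff_forall_apply.1 hn a, sub_self, sub_self]
  have hg0 : F g = 0 := by rw [hF, ← ha, sub_one_apply, sub_self]
  -- The commutator of `g` and `h` lies in the kernel, so `F (g * h) = F (h * g)`. With `F g = 0`
  -- this says that `ρ g - 1` kills `F h`.
  have htor : ∀ h, p ^ k • F h = 0 := by
    intro h
    refine hA.pow_smul_eq_zero_of_apply_eq_zero hu ?_
    have h1 : F (g * h * g⁻¹ * h⁻¹ * (h * g)) = F (h * g) := by
      rw [hmul, hker' _ (commutator_mem_ker hA g h),
        mem_ker_iff_forall_apply.1 (commutator_mem_ker hA g h), zero_add]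
    rw [show g * h * g⁻¹ * h⁻¹ * (h * g) = g * h by group, hmul, hmul, hg0, map_zero, zero_add,
      add_zero] at h1
    rw [sub_one_apply, h1, sub_self]
  obtain _ | k := k
  · simpa using htor h
  -- The values lie in torsion on which `Γ` acts trivially, so `F` is a homomorphism. It vanishes on
  -- the powers of `g` and on some `torsionKer p ρ m`, which together give all of `Γ`.
  have hadd : ∀ x y, F (x * y) = F x + F y := fun x y => by rw [hmul, htriv x _ (htor y)]
  have hopen : IsOpen {h | F h = 0} := hlc {0}
  obtain ⟨m, hm⟩ := exists_torsionKer_subset hA hρ hopen hker'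
  obtain ⟨i, hi⟩ := exists_pow_apply_eq hA hp hp2 (by omega) hg htriv m h
  have hpow : ∀ i : ℕ, F (g ^ i) = 0 := by
    intro i
    induction i with
    | zero => rw [pow_zero, cocycle_one hmul]
    | succ i ih => rw [pow_succ, hadd, ih, hg0, add_zero]
  have h2 : F ((g ^ i)⁻¹ * h) = 0 := hm hi
  rw [← mul_inv_cancel_left (g ^ i) h, hadd, hpow, h2, add_zero]

end Topology

end QuasiCyclicAction

/-! ### Extending equivariant homomorphisms from the kernel of the action -/

section CocycleExtension

open scoped Topology

variable {p : ℕ} {Γ A : Type*} [Group Γ] [AddCommGroup A] {ρ : Γ →* AddMonoid.End A}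

lemma bijective_of_not_mem_torsionKer_one (hA : IsQuasiCyclic p A) {g : Γ}
    (hg : g ∉ torsionKer p ρ (0 + 1)) : Function.Bijective (ρ g - 1 : AddMonoid.End A) := by
  have hu := exists_sub_one_apply_ne_zero hg
  refine ⟨?_, hA.surjective_of_apply_ne_zero hu⟩
  rw [injective_iff_map_eq_zero]
  intro a ha
  simpa using hA.pow_smul_eq_zero_of_apply_eq_zero hu ha

variable [TopologicalSpace Γ] [IsTopologicalGroup Γ]

lemma mem_contZ1_of_mem_nhds {F : Γ → A} (hmul : ∀ g h, F (g * h) = F g + ρ g (F h)) {U : Set Γ}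
    (hU : U ∈ 𝓝 1) (h0 : ∀ h ∈ U, F h = 0) : F ∈ contZ1 ρ := by
  refine ⟨?_, hmul⟩
  rw [IsLocallyConstant.iff_eventually_eq]
  intro x
  have : Filter.Tendsto (fun y => x⁻¹ * y) (𝓝 x) (𝓝 1) := by
    have h1 : Continuous fun y : Γ => x⁻¹ * y := by fun_prop
    simpa using h1.tendsto x
  filter_upwards [this hU] with y hy
  have h2 : F y = F (x * (x⁻¹ * y)) := by rw [mul_inv_cancel_left]
  rw [h2, hmul, h0 _ hy, map_zero, add_zero]

variable {f : Γ → A}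

/-- An extension normalized by `F g = 0` must satisfy `(ρ g - 1) (F h) = f (g * h * g⁻¹ * h⁻¹)`, and
bijectivity of `ρ g - 1` turns this into a definition. The cocycle identity comes from `[g, x * y] =
[g, x] * (x * [g, y] * x⁻¹)`. -/
lemma exists_cocycle_extension_of_bijective (hA : IsQuasiCyclic p A)
    (hadd : ∀ n ∈ ρ.ker, ∀ n' ∈ ρ.ker, f (n * n') = f n + f n')
    (hconj : ∀ σ, ∀ n ∈ ρ.ker, f (σ * n * σ⁻¹) = ρ σ (f n))
    {U : Set Γ} (hU : U ∈ 𝓝 1) (hfU : ∀ n ∈ ρ.ker, n ∈ U → f n = 0)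
    {g : Γ} (hg : Function.Bijective (ρ g - 1 : AddMonoid.End A)) :
    ∃ F ∈ contZ1 ρ, ∀ n ∈ ρ.ker, F n = f n := by
  choose F hF using fun h => hg.2 (f (g * h * g⁻¹ * h⁻¹))
  refine ⟨F, mem_contZ1_of_mem_nhds (U := (fun h => g * h * g⁻¹ * h⁻¹) ⁻¹' U) ?_ ?_ ?_, ?_⟩
  · intro x y
    apply hg.1
    rw [map_add, sub_one_apply g (ρ x (F y)), hA.end_comm (ρ g), ← map_sub, ← sub_one_apply, hF, hF, hF,
      ← hconj x _ (commutator_mem_ker hA g y), ← hadd _ (commutator_mem_ker hA g x) _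
        (MonoidHom.normal_ker ρ |>.conj_mem _ (commutator_mem_ker hA g y) _)]
    congr 1
    group
  · have h1 : Continuous fun h : Γ => g * h * g⁻¹ * h⁻¹ := by fun_prop
    refine h1.continuousAt.preimage_mem_nhds ?_
    simpa using hU
  · intro h hh
    apply hg.1
    rw [hF, map_zero, hfU _ (commutator_mem_ker hA g h) hh]
  · intro n hn
    apply hg.1
    have hinv : f n⁻¹ = - f n := by
      have h1 := hadd n hn n⁻¹ (inv_mem hn)
      have h2 := hadd 1 (one_mem _) 1 (one_mem _)
      rw [mul_one, left_eq_add] at h2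
      rw [mul_inv_cancel, h2] at h1
      rw [eq_neg_iff_add_eq_zero, add_comm, ← h1]
    -- For `n` in the kernel, the commutator is `(g * n * g⁻¹) * n⁻¹`, whose image under `f` is `ρ g
    -- (f n) - f n` by equivariance.
    rw [hF, sub_one_apply, hadd _ (MonoidHom.normal_ker ρ |>.conj_mem _ hn _) _ (inv_mem hn), hconj _ _ hn,
      hinv, sub_eq_add_neg]

/-- A small enough normal open subgroup `V` such that no nontrivial values of `f` occur on the
elements of the kernel that are congruent to a power of `g` modulo `V`. -/
lemma exists_open_normal_forall_pow [CompactSpace Γ] (hA : IsQuasiCyclic p A) (hp : p.Prime)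
    (hp2 : p ≠ 2) (hρ : ∀ a, IsOpen {g | ρ g a = a})
    (hadd : ∀ n ∈ ρ.ker, ∀ n' ∈ ρ.ker, f (n * n') = f n + f n')
    {V : Subgroup Γ} [V.Normal] (hV : IsOpen (V : Set Γ)) (hfV : ∀ n ∈ ρ.ker, n ∈ V → f n = 0)
    {r : ℕ} (hr : ∀ n ∈ ρ.ker, p ^ r • f n = 0) {k : ℕ} (hk : 1 ≤ k)
    {g : Γ} (hg : g ∉ torsionKer p ρ (k + 1)) (htriv : ∀ h, h ∈ torsionKer p ρ k) :
    ∃ V' : Subgroup Γ, V'.Normal ∧ IsOpen (V' : Set Γ) ∧ V' ≤ V ∧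
      ∀ t : ℕ, ∀ n ∈ ρ.ker, ∀ v ∈ V', g ^ t = n * v → f n = 0 := by
  have hadd_pow : ∀ n ∈ ρ.ker, ∀ i : ℕ, f (n ^ i) = i • f n := by
    intro n hn i
    induction i with
    | zero => rw [pow_zero, zero_smul]; exact hfV 1 (one_mem _) (one_mem _)
    | succ i ih => rw [pow_succ, hadd _ (pow_mem hn _) _ hn, ih, succ_nsmul]
  let U := ρ.ker ⊔ V
  have hUopen : IsOpen (U : Set Γ) := Subgroup.isOpen_mono (le_sup_right : V ≤ U) hV
  have : Finite (Γ ⧸ U) := Subgroup.quotient_finite_of_isOpen U hUopen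
  have hUn : U.Normal := inferInstanceAs (ρ.ker ⊔ V).Normal
  let s := orderOf (g : Γ ⧸ U)
  have hs : s ≠ 0 := (orderOf_pos _).ne'
  obtain ⟨a, s0, hs0, hss⟩ := Nat.exists_eq_pow_mul_and_not_dvd hs p hp.ne_one
  have hVo := isOpen_torsionKer (p := p) hA hρ (k + (a + r))
  -- In the exponent, `k` is lost to the valuation of `g - 1`, `a` is the `p`-part of the order `s`
  -- of `g` modulo `U`, and `r` kills the values of `f`. If `g ^ t = n * v`, this forces `s * p ^ r
  -- ∣ t`.
  refine ⟨V ⊓ torsionKer p ρ (k + (a + r)), inferInstance, ?_, inf_le_left, ?_⟩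
  · rw [Subgroup.coe_inf]
    exact hV.inter hVo
  intro t n hn v hv htn
  have h1 : p ^ (a + r) ∣ t := by
    refine pow_dvd_of_pow_mem_torsionKer hA hp hp2 hk hg htriv ?_
    rw [htn]
    exact mul_mem (ker_le_torsionKer _ _ _ hn) hv.2
  have h2 : s ∣ t := by
    rw [orderOf_dvd_iff_pow_eq_one, ← QuotientGroup.mk_pow, QuotientGroup.eq_one_iff, htn]
    exact mul_mem (Subgroup.mem_sup_left hn) (Subgroup.mem_sup_right hv.1)
  have h3 : s * p ^ r ∣ t := by
    have h4 : s0 ∣ t := (Dvd.intro_left _ hss.symm).trans h2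
    have h5 : (p ^ (a + r)).Coprime s0 := ((Nat.Prime.coprime_iff_not_dvd hp).2 hs0).pow_left _
    have := h5.mul_dvd_of_dvd_of_dvd h1 h4
    rw [hss]
    convert this using 1
    ring
  obtain ⟨q, rfl⟩ := h3
  have h6 : g ^ (s * q) ∈ U := by
    rw [← QuotientGroup.eq_one_iff, QuotientGroup.mk_pow, ← orderOf_dvd_iff_pow_eq_one]
    exact Dvd.intro q rfl
  obtain ⟨n2, hn2, v2, hv2, h7⟩ := Subgroup.mem_sup_of_normal_right.1 h6
  -- Modulo `V`, `g ^ t = (g ^ (s * q)) ^ p ^ r` is both `n` and `n2 ^ p ^ r`; hence `f n = p ^ r •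
  -- f n2 = 0`.
  have h8 : (n2 ^ p ^ r)⁻¹ * n ∈ V := by
    have h9 : ((n2 ^ p ^ r : Γ) : Γ ⧸ V) = (n : Γ ⧸ V) := by
      have e1 : ((g ^ (s * q) : Γ) : Γ ⧸ V) = n2 := by
        rw [← h7, QuotientGroup.mk_mul, (QuotientGroup.eq_one_iff v2).2 hv2, mul_one]
      have e2 : ((g ^ (s * p ^ r * q) : Γ) : Γ ⧸ V) = n := by
        rw [htn, QuotientGroup.mk_mul, (QuotientGroup.eq_one_iff v).2 hv.1, mul_one]
      rw [← e2, QuotientGroup.mk_pow, ← e1, ← QuotientGroup.mk_pow, ← pow_mul]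
      congr 2
      ring
    exact QuotientGroup.eq.1 h9
  have h10 := hfV _ (mul_mem (inv_mem (pow_mem hn2 _)) hn) h8
  rw [← mul_inv_cancel_left (n2 ^ p ^ r) n, hadd _ (pow_mem hn2 _) _
    (mul_mem (inv_mem (pow_mem hn2 _)) hn), h10, hadd_pow _ hn2, hr _ hn2, add_zero]

/-- An equivariant continuous homomorphism from the kernel of the action to a `p`-quasi-cyclic
module, `p` odd, extends to a continuous cocycle of the whole compact group. -/
theorem exists_cocycle_extension [CompactSpace Γ] (hA : IsQuasiCyclic p A) (hp : p.Prime)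
    (hp2 : p ≠ 2) (hρ : ∀ a, IsOpen {g | ρ g a = a})
    (hbasis : ∀ U ∈ 𝓝 (1 : Γ), ∃ V : Subgroup Γ, V.Normal ∧ IsOpen (V : Set Γ) ∧ (V : Set Γ) ⊆ U)
    (hadd : ∀ n ∈ ρ.ker, ∀ n' ∈ ρ.ker, f (n * n') = f n + f n')
    (hconj : ∀ σ, ∀ n ∈ ρ.ker, f (σ * n * σ⁻¹) = ρ σ (f n))
    {U : Set Γ} (hU : U ∈ 𝓝 1) (hfU : ∀ n ∈ ρ.ker, n ∈ U → f n = 0)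
    {r : ℕ} (hr : ∀ n ∈ ρ.ker, p ^ r • f n = 0) :
    ∃ F ∈ contZ1 ρ, ∀ n ∈ ρ.ker, F n = f n := by
  by_cases htriv : ∃ g, g ∉ ρ.ker
  swap
  · push Not at htriv
    refine ⟨f, mem_contZ1_of_mem_nhds (fun x y => ?_) hU fun h hh => hfU h (htriv h) hh, fun _ _ => rfl⟩
    rw [hadd x (htriv x) y (htriv y), mem_ker_iff_forall_apply.1 (htriv x)]
  obtain ⟨k, g, hg, htriv⟩ := exists_first_nontrivial hA htriv
  -- If `k = 0`, some `ρ g - 1` is bijective. If `k ≥ 1`, the action factors through `1 + p ^ k ℤ_p`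
  -- and `g` topologically generates the image.
  obtain rfl | hk := Nat.eq_zero_or_pos k
  · exact exists_cocycle_extension_of_bijective hA hadd hconj hU hfU
      (bijective_of_not_mem_torsionKer_one hA hg)
  obtain ⟨V0, hV0n, hV0, hV0U⟩ := hbasis U hU
  -- Intersecting with `torsionKer p ρ r` makes `V` fix every value of `f`.
  obtain ⟨V, hVn, hV, hVV0, hpow⟩ := exists_open_normal_forall_pow (V := V0 ⊓ torsionKer p ρ r) hA hp hp2
    hρ hadd (by
      rw [Subgroup.coe_inf]
      exact hV0.inter (isOpen_torsionKer hA hρ r)) (fun n hn hn' => hfU n hn (hV0U hn'.1)) hr hk hg htriv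
  have hVtriv : ∀ v ∈ V, ∀ n ∈ ρ.ker, ρ v (f n) = f n := fun v hv n hn => (hVV0 hv).2 _ (hr n hn)
  have hf1 : f 1 = 0 := hpow 0 1 (one_mem _) 1 (one_mem _) (by simp)
  have hf_eq : ∀ n ∈ ρ.ker, ∀ n' ∈ ρ.ker, f (n * n'⁻¹) = 0 → f n = f n' := by
    intro n hn n' hn' h
    have := hadd (n * n'⁻¹) (mul_mem hn (inv_mem hn')) n' hn'
    rwa [inv_mul_cancel_right, h, zero_add] at this
  -- the value at `g ^ i * n * v` is well defined
  have hwd : ∀ (i j : ℕ), i ≤ j → ∀ n ∈ ρ.ker, ∀ n' ∈ ρ.ker, ∀ v ∈ V, ∀ v' ∈ V,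
      g ^ i * n * v = g ^ j * n' * v' → ρ (g ^ i) (f n) = ρ (g ^ j) (f n') := by
    intro i j hij n hn n' hn' v hv v' hv' he
    obtain ⟨t, rfl⟩ := Nat.exists_eq_add_of_le hij
    have h1 : g ^ t = (n * n'⁻¹) * (n' * (v * v'⁻¹) * n'⁻¹) := by
      rw [pow_add, mul_assoc, mul_assoc, mul_assoc, mul_left_cancel_iff] at he
      rw [eq_mul_inv_of_mul_eq he.symm]
      group
    have hv1 : n' * (v * v'⁻¹) * n'⁻¹ ∈ V := hVn.conj_mem _ (mul_mem hv (inv_mem hv')) _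
    have hn1 := mul_mem hn (inv_mem hn')
    have h2 := hpow t _ hn1 _ hv1 h1
    rw [hf_eq n hn n' hn' h2, pow_add, h1, End.mul_apply', End.mul_apply', hVtriv _ hv1 _ hn',
      mem_ker_iff_forall_apply.1 hn1]
  have hopen : IsOpen ((ρ.ker ⊔ V : Subgroup Γ) : Set Γ) :=
    Subgroup.isOpen_mono (le_sup_right : V ≤ _) hV
  -- Powers of `g` reach every class modulo `torsionKer p ρ m`, which lies in `ρ.ker ⊔ V`; so every
  -- element of `Γ` has the form `g ^ i * n * v`.
  obtain ⟨m, hm⟩ := exists_torsionKer_subset (p := p) hA hρ hopen (le_sup_left : ρ.ker ≤ ρ.ker ⊔ V)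
  have hex : ∀ h, ∃ (i : ℕ) (n : Γ) (v : Γ), n ∈ ρ.ker ∧ v ∈ V ∧ h = g ^ i * n * v := by
    intro h
    obtain ⟨i, hi⟩ := exists_pow_apply_eq hA hp hp2 hk hg htriv m h
    obtain ⟨n, hn, v, hv, he⟩ := Subgroup.mem_sup_of_normal_right.1 (hm hi)
    refine ⟨i, n, v, hn, hv, ?_⟩
    rw [mul_assoc, he, mul_inv_cancel_left]
  choose i n v hn hv hdec using hex
  have hF : ∀ (j : ℕ), ∀ n' ∈ ρ.ker, ∀ v' ∈ V,
      ρ (g ^ i (g ^ j * n' * v')) (f (n (g ^ j * n' * v'))) = ρ (g ^ j) (f n') := by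
    intro j n' hn' v' hv'
    have hd := hdec (g ^ j * n' * v')
    obtain h | h := le_total (i (g ^ j * n' * v')) j
    · exact hwd _ _ h _ (hn _) _ hn' _ (hv _) _ hv' hd.symm
    · exact (hwd _ _ h _ hn' _ (hn _) _ hv' _ (hv _) hd).symm
  -- This is the value forced by the cocycle rule if the extension is to vanish on `g` and on `V`.
  refine ⟨fun h => ρ (g ^ i h) (f (n h)), mem_contZ1_of_mem_nhds ?_
    (hV.mem_nhds (one_mem V)) ?_, ?_⟩
  · intro x y
    have hnn : (g ^ i y)⁻¹ * n x * g ^ i y ∈ ρ.ker := by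
      simpa using (MonoidHom.normal_ker ρ).conj_mem _ (hn x) (g ^ i y)⁻¹
    -- Moving `g ^ i y` to the left past `n x`, and `g ^ i y * n y` past `v x`, puts the product in
    -- the form `g ^ j * n' * v'`.
    have hxy : x * y = g ^ (i x + i y) * ((g ^ i y)⁻¹ * n x * g ^ i y * n y) *
        ((g ^ i y * n y)⁻¹ * v x * (g ^ i y * n y) * v y) := by
      conv_lhs => rw [hdec x, hdec y]
      rw [pow_add]
      group
    have hvv : (g ^ i y * n y)⁻¹ * v x * (g ^ i y * n y) ∈ V := by
      simpa using hVn.conj_mem _ (hv x) (g ^ i y * n y)⁻¹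
    have h1 := hF (i x + i y) _ (mul_mem hnn (hn y)) _ (mul_mem hvv (hv y))
    rw [← hxy] at h1
    have h2 : f ((g ^ i y)⁻¹ * n x * g ^ i y) = ρ (g ^ i y)⁻¹ (f (n x)) := by
      simpa using hconj (g ^ i y)⁻¹ _ (hn x)
    have h3 : ρ x (ρ (g ^ i y) (f (n y))) = ρ (g ^ i x) (ρ (g ^ i y) (f (n y))) := by
      conv_lhs => rw [hdec x]
      rw [End.mul_apply', End.mul_apply', ← hconj _ _ (hn y),
        hVtriv _ (hv x) _ ((MonoidHom.normal_ker ρ).conj_mem _ (hn y) _),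
        mem_ker_iff_forall_apply.1 (hn x)]
    rw [h1, h3, hadd _ hnn _ (hn y), h2, map_add, pow_add, End.mul_apply', End.mul_apply',
      ← End.mul_apply' _ (g ^ i y), mul_inv_cancel, map_one]
    rfl
  · intro h hh
    simpa [hf1] using hF 0 1 (one_mem _) h hh
  · intro n' hn'
    have h1 := hF 0 n' hn' 1 (one_mem _)
    rw [pow_zero, one_mul, mul_one] at h1
    exact h1.trans (by rw [map_one]; rfl)

end CocycleExtension

/-! ### Restriction in Galois cohomology: injectivity and image -/

section GaloisCohomology

open scoped Topology

variable {p : ℕ}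

section

variable {G A : Type*} [Group G] [TopologicalSpace G] [AddCommGroup A] {ρ : G →* AddMonoid.End A}

lemma contH1_mk_eq_zero_iff (f : contZ1 ρ) :
    (QuotientAddGroup.mk f : contH1 ρ) = 0 ↔ ∃ a : A, ∀ g, f.1 g = ρ g a - a := by
  rw [QuotientAddGroup.eq_zero_iff]
  rfl

lemma contH1_mk_eq_iff (f f' : contZ1 ρ) :
    (QuotientAddGroup.mk f : contH1 ρ) = QuotientAddGroup.mk f' ↔
      ∃ a : A, ∀ g, f.1 g - f'.1 g = ρ g a - a := by
  rw [← sub_eq_zero, ← QuotientAddGroup.mk_sub, contH1_mk_eq_zero_iff]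
  rfl

end

variable {K : Type u} {Kbar : Type v} [Field K] [Field Kbar] [Algebra K Kbar] [IsGalois K Kbar]
  {A : Type w} [AddCommGroup A] {ρ : Gal(Kbar/K) →* AddMonoid.End A}

instance compactSpace_fixingSubgroup (F : IntermediateField K Kbar) : CompactSpace F.fixingSubgroup :=
  isCompact_iff_compactSpace.1 (InfiniteGalois.fixingSubgroup_isClosed F).isCompact

lemma exists_open_normal_subset (F : IntermediateField K Kbar) {U : Set F.fixingSubgroup}
    (hU : U ∈ 𝓝 1) :
    ∃ V : Subgroup F.fixingSubgroup, V.Normal ∧ IsOpen (V : Set F.fixingSubgroup) ∧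
      (V : Set F.fixingSubgroup) ⊆ U := by
  rw [nhds_subtype_eq_comap, Filter.mem_comap] at hU
  obtain ⟨U', hU', hUU'⟩ := hU
  obtain ⟨E, hE⟩ := (InfiniteGalois.krullTopology_mem_nhds_one_iff_of_isGalois U').1 hU'
  refine ⟨E.1.fixingSubgroup.subgroupOf F.fixingSubgroup, inferInstance, ?_, ?_⟩
  · exact (IntermediateField.fixingSubgroup_isOpen E.1).preimage continuous_subtype_val
  · intro g hg
    exact hUU' (hE hg)

variable {L F : IntermediateField K Kbar}

/-- `Gal(Kbar/F)` acts trivially on `A`, so a cocycle that becomes a coboundary over `F` vanishes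
there identically, and the vanishing theorem for `Gal(Kbar/L)` applies. -/
lemma galRes_injective (hA : IsQuasiCyclic p A) (hp : p.Prime) (hp2 : p ≠ 2)
    (hρ : ∀ a, IsOpen {g | ρ g a = a}) (h : L ≤ F)
    (hker : ∀ σ, σ ∈ F.fixingSubgroup ↔ σ ∈ L.fixingSubgroup ∧ ∀ a, ρ σ a = a) :
    Function.Injective (galRes ρ h) := by
  rw [injective_iff_map_eq_zero]
  intro c hc
  obtain ⟨f, rfl⟩ := QuotientAddGroup.mk_surjective c
  obtain ⟨a, ha⟩ := (contH1_mk_eq_zero_iff _).1 hc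
  rw [contH1_mk_eq_zero_iff]
  refine mem_contB1_of_forall_mem_ker (ρ := ρ.comp L.fixingSubgroup.subtype) hA hp hp2
    (fun a => (hρ a).preimage continuous_subtype_val) f.2 fun n hn => ?_
  have hn' : n.1 ∈ F.fixingSubgroup := (hker _).2 ⟨n.2, mem_ker_iff_forall_apply.1 hn⟩
  refine (ha ⟨n.1, hn'⟩).trans ?_
  rw [sub_eq_zero]
  exact ((hker _).1 hn').2 a

lemma galConj_galRes [IsGalois K L] [IsGalois K F] (h : L ≤ F) (σ : Gal(Kbar/K)) (c : galH1 ρ L) :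
    galRes ρ h (galConj ρ L σ c) = galConj ρ F σ (galRes ρ h c) := by
  obtain ⟨f, rfl⟩ := QuotientAddGroup.mk_surjective c
  rfl

/-- Inner conjugation acts trivially on cohomology: evaluating `f` on both sides of `σ * (σ⁻¹ * g *
σ) = g * σ` shows that the difference is the coboundary of `f σ`. -/
lemma galConj_galRes_of_mem [IsGalois K F] (h : L ≤ F) {σ : Gal(Kbar/K)}
    (hσ : σ ∈ L.fixingSubgroup) (c : galH1 ρ L) :
    galConj ρ F σ (galRes ρ h c) = galRes ρ h c := by
  obtain ⟨f, rfl⟩ := QuotientAddGroup.mk_surjective c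
  refine (contH1_mk_eq_iff _ _).2 ⟨f.1 ⟨σ, hσ⟩, fun g => ?_⟩
  have hg : g.1 ∈ L.fixingSubgroup := IntermediateField.fixingSubgroup_antitone h g.2
  change ρ σ (f.1 ⟨σ⁻¹ * g.1 * σ⁻¹⁻¹, _⟩) - f.1 ⟨g.1, hg⟩ = ρ g.1 (f.1 ⟨σ, hσ⟩) - f.1 ⟨σ, hσ⟩
  let s : L.fixingSubgroup := ⟨σ, hσ⟩
  let t : L.fixingSubgroup := ⟨g.1, hg⟩
  have h1 : f.1 (s * (s⁻¹ * t * s⁻¹⁻¹)) = f.1 (t * s) := by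
    group
  rw [f.2.2 s, f.2.2 t] at h1
  have h2 : f.1 s + ρ σ (f.1 (s⁻¹ * t * s⁻¹⁻¹)) = f.1 t + ρ g.1 (f.1 s) := h1
  rw [sub_eq_sub_iff_add_eq_add, add_comm, add_comm (ρ g.1 _)]
  exact h2

/-- Over `F` the module is trivial, so cocycles are homomorphisms and coboundaries are zero.
Invariance of the class is therefore equivariance of the homomorphism itself, which is the
hypothesis of `exists_cocycle_extension`. -/
lemma mem_range_galRes [IsGalois K F] (hA : IsQuasiCyclic p A) (hp : p.Prime) (hp2 : p ≠ 2)
    (hρ : ∀ a, IsOpen {g | ρ g a = a}) (h : L ≤ F)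
    (hker : ∀ σ, σ ∈ F.fixingSubgroup ↔ σ ∈ L.fixingSubgroup ∧ ∀ a, ρ σ a = a) (c : galH1 ρ F)
    (hc : ∀ σ ∈ L.fixingSubgroup, galConj ρ F σ c = c) : ∃ c', galRes ρ h c' = c := by
  classical
  obtain ⟨f, rfl⟩ := QuotientAddGroup.mk_surjective c
  have htriv (σ : F.fixingSubgroup) (a : A) : ρ σ.1 a = a := ((hker _).1 σ.2).2 a
  let f' : L.fixingSubgroup → A := fun g => if hg : g.1 ∈ F.fixingSubgroup then f.1 ⟨g.1, hg⟩ else 0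
  have hf' (g : L.fixingSubgroup) (hg : g.1 ∈ F.fixingSubgroup) : f' g = f.1 ⟨g.1, hg⟩ := dif_pos hg
  have hmem {n : L.fixingSubgroup} (hn : n ∈ (ρ.comp L.fixingSubgroup.subtype).ker) :
      n.1 ∈ F.fixingSubgroup := (hker _).2 ⟨n.2, mem_ker_iff_forall_apply.1 hn⟩
  have hadd (x y : F.fixingSubgroup) : f.1 (x * y) = f.1 x + f.1 y := by
    rw [f.2.2]
    exact congrArg _ (htriv x _)
  -- A locally constant function on a compact space has finite range, so one power of `p` kills all
  -- its values.
  obtain ⟨r, hr⟩ : ∃ r : ℕ, ∀ x, p ^ r • f.1 x = 0 := by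
    choose m hm using hA.exists_pow_smul_eq_zero
    obtain ⟨r, hr⟩ := (f.2.1.range_finite.image m).bddAbove
    exact ⟨r, fun x => IsQuasiCyclic.pow_smul_eq_zero_of_le (hr ⟨_, ⟨x, rfl⟩, rfl⟩) (hm _)⟩
  obtain ⟨U, hU, hUf⟩ := isOpen_induced_iff.1 (f.2.1 {0})
  have hf1 : f.1 1 = 0 := by
    have := hadd 1 1
    rwa [mul_one, left_eq_add] at this
  have hUmem (x : F.fixingSubgroup) : x.1 ∈ U ↔ f.1 x = 0 := Set.ext_iff.1 hUf x
  obtain ⟨E, hE, hEf⟩ := exists_cocycle_extension (ρ := ρ.comp L.fixingSubgroup.subtype) (f := f')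
    hA hp hp2 (fun a => (hρ a).preimage continuous_subtype_val)
    (fun U hU => exists_open_normal_subset L hU)
    (fun n hn n' hn' => by
      rw [hf' _ (hmem hn), hf' _ (hmem hn'), hf' _ (hmem (mul_mem hn hn'))]
      exact hadd ⟨n.1, hmem hn⟩ ⟨n'.1, hmem hn'⟩)
    (fun σ n hn => by
      have hn1 := (MonoidHom.normal_ker (ρ.comp L.fixingSubgroup.subtype)).conj_mem _ hn σ
      obtain ⟨a, ha⟩ := (contH1_mk_eq_iff _ _).1 (hc σ.1 σ.2)
      have h1 := ha ⟨_, hmem hn1⟩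
      have h2 := h1.trans (sub_eq_zero.2 (htriv ⟨_, hmem hn1⟩ a))
      rw [hf' _ (hmem hn), hf' _ (hmem hn1), ← sub_eq_zero.1 h2]
      change ρ σ.1 (f.1 ⟨σ.1⁻¹ * (σ.1 * n.1 * σ.1⁻¹) * σ.1⁻¹⁻¹, _⟩) = ρ σ.1 _
      congr 3
      group)
    (U := Subtype.val ⁻¹' U)
    (continuous_subtype_val.continuousAt.preimage_mem_nhds
      (hU.mem_nhds ((hUmem 1).2 hf1)))
    (fun n hn hnU => by
      rw [hf' _ (hmem hn)]
      exact (hUmem ⟨n.1, hmem hn⟩).1 hnU)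
    (r := r) (fun n hn => by rw [hf' _ (hmem hn)]; exact hr _)
  refine ⟨QuotientAddGroup.mk ⟨E, hE⟩, congrArg _ (Subtype.ext (funext fun x => ?_))⟩
  have hx : x.1 ∈ L.fixingSubgroup := IntermediateField.fixingSubgroup_antitone h x.2
  exact (hEf ⟨x.1, hx⟩ (mem_ker_iff_forall_apply.2 fun a => htriv x a)).trans (hf' _ x.2)

end GaloisCohomology

/-! ### Comparison of the local conditions -/

section Localization

variable {p : ℕ} {K : Type u} {Kbar : Type v} [Field K] [Field Kbar] [Algebra K Kbar] [Normal K Kbar]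
  {Kv : Type u} {Ω : Type w} [Field Kv] [Field Ω] [Algebra K Kv] [Algebra Kv Ω] [Algebra K Ω]
  [IsScalarTower K Kv Ω] {A : Type*} [AddCommGroup A]
  {ρ : Gal(Kbar/K) →* AddMonoid.End A} {L F : IntermediateField K Kbar}

lemma mem_fixingSubgroup_localField {τ : Kbar →ₐ[K] Ω} {g : Gal(Ω/Kv)}
    (hg : localToGlobal τ g ∈ F.fixingSubgroup) : g ∈ (localField Kv τ F).fixingSubgroup := by
  rintro ⟨x, hx⟩
  change g x = x
  induction hx using IntermediateField.adjoin_induction with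
  | mem x hx =>
    obtain ⟨y, hy, rfl⟩ := hx
    rw [← apply_localToGlobal]
    exact congrArg τ (hg ⟨y, hy⟩)
  | algebraMap x => exact AlgEquiv.commutes _ x
  | add x y _ _ hx hy => rw [map_add, hx, hy]
  | inv x _ hx => rw [map_inv₀, hx]
  | mul x y _ _ hx hy => rw [map_mul, hx, hy]

/-- An element of the local group over `L` that acts trivially on `A` restricts to `Gal(Kbar/F)` and
hence fixes `Kv · τ(F)`. A class dying over `Kv · τ(F)` therefore vanishes on the kernel of the
local action, and the same vanishing theorem applies to `Gal(Ω / Kv · τ(L))`. -/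
lemma localization_galRes_eq_zero_iff [IsGalois Kv Ω] (hA : IsQuasiCyclic p A) (hp : p.Prime) (hp2 : p ≠ 2)
    (hρ : ∀ a, IsOpen {g | ρ g a = a}) (h : L ≤ F)
    (hker : ∀ σ, σ ∈ F.fixingSubgroup ↔ σ ∈ L.fixingSubgroup ∧ ∀ a, ρ σ a = a)
    (τ : Kbar →ₐ[K] Ω) (c : galH1 ρ L) :
    localization Kv ρ τ F (galRes ρ h c) = 0 ↔ localization Kv ρ τ L c = 0 := by
  obtain ⟨f, rfl⟩ := QuotientAddGroup.mk_surjective c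
  have hle : localField Kv τ L ≤ localField Kv τ F :=
    IntermediateField.adjoin.mono _ _ _ (Set.image_mono h)
  constructor
  · intro hc
    obtain ⟨a, ha⟩ := (contH1_mk_eq_zero_iff _).1 hc
    refine (contH1_mk_eq_zero_iff _).2 ?_
    have hcont := continuous_localToGlobalOver (Kv := Kv) τ L
    refine mem_contB1_of_forall_mem_ker
      (ρ := (ρ.comp L.fixingSubgroup.subtype).comp (localToGlobalOver Kv τ L)) hA hp hp2
      (fun a => (hρ a).preimage (continuous_subtype_val.comp hcont))
      ((contZ1Map _ _ (localToGlobalOver Kv τ L) hcont (AddMonoidHom.id A) (fun _ _ => rfl)) f).2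
      fun n hn => ?_
    have hn1 : localToGlobal τ n.1 ∈ F.fixingSubgroup :=
      (hker _).2 ⟨(localToGlobalOver Kv τ L n).2, mem_ker_iff_forall_apply.1 hn⟩
    refine (ha ⟨n.1, mem_fixingSubgroup_localField hn1⟩).trans ?_
    rw [sub_eq_zero]
    exact ((hker _).1 hn1).2 a
  · intro hc
    obtain ⟨a, ha⟩ := (contH1_mk_eq_zero_iff _).1 hc
    exact (contH1_mk_eq_zero_iff _).2
      ⟨a, fun g => ha ⟨g.1, IntermediateField.fixingSubgroup_antitone hle g.2⟩⟩

end Localization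

/-! ### Control theorem for Selmer groups -/

section Selmer

variable {p : ℕ} {K : Type u} [Field K] [NumberField K] {Kbar : Type v} [Field Kbar] [Algebra K Kbar]
  [IsGalois K Kbar] {A : Type w} [AddCommGroup A] {ρ : Gal(Kbar/K) →* AddMonoid.End A}
  {L F : IntermediateField K Kbar}

lemma mem_imprimitiveSelmer_iff {S : Finset (HeightOneSpectrum (𝓞 K))} {c : galH1 ρ F} :
    c ∈ imprimitiveSelmer ρ S F ↔ ∀ v ∉ S,
      ∀ τ : Kbar →ₐ[K] AlgebraicClosure (v.adicCompletion K),
        localization (v.adicCompletion K) ρ τ F c = 0 := by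
  simp only [imprimitiveSelmer, AddSubgroup.mem_iInf, AddMonoidHom.mem_ker]

lemma galRes_mem_imprimitiveSelmer_iff (hA : IsQuasiCyclic p A) (hp : p.Prime) (hp2 : p ≠ 2)
    (hρ : ∀ a, IsOpen {g | ρ g a = a}) (h : L ≤ F)
    (hker : ∀ σ, σ ∈ F.fixingSubgroup ↔ σ ∈ L.fixingSubgroup ∧ ∀ a, ρ σ a = a)
    (S : Finset (HeightOneSpectrum (𝓞 K))) (c : galH1 ρ L) :
    galRes ρ h c ∈ imprimitiveSelmer ρ S F ↔ c ∈ imprimitiveSelmer ρ S L := by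
  rw [mem_imprimitiveSelmer_iff, mem_imprimitiveSelmer_iff]
  refine forall_congr' fun v => forall_congr' fun _ => forall_congr' fun τ => ?_
  -- Characteristic zero makes the algebraic closure of the completion a Galois extension.
  have : CharZero (v.adicCompletion K) := charZero_of_injective_algebraMap
    (FaithfulSMul.algebraMap_injective K (v.adicCompletion K))
  exact localization_galRes_eq_zero_iff hA hp hp2 hρ h hker τ c

/-- Control theorem: for a `p`-quasi-cyclic Galois module, `p` odd, restriction to the field cut out
by the module identifies the Selmer group with the invariants of the Selmer group upstairs. -/
theorem exists_selmer_equiv [IsGalois K F] (hA : IsQuasiCyclic p A) (hp : p.Prime) (hp2 : p ≠ 2)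
    (hρ : ∀ a, IsOpen {g | ρ g a = a}) (h : L ≤ F)
    (hker : ∀ σ, σ ∈ F.fixingSubgroup ↔ σ ∈ L.fixingSubgroup ∧ ∀ a, ρ σ a = a)
    (S : Finset (HeightOneSpectrum (𝓞 K))) :
    ∃ e : imprimitiveSelmer ρ S L ≃+ selmerInvariants ρ S L F,
      ∀ c : imprimitiveSelmer ρ S L, (e c : galH1 ρ F) = galRes ρ h c := by
  have hinv {c : galH1 ρ F} : c ∈ selmerInvariants ρ S L F ↔
      c ∈ imprimitiveSelmer ρ S F ∧ ∀ σ ∈ L.fixingSubgroup, galConj ρ F σ c = c := by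
    simp only [selmerInvariants, AddSubgroup.mem_inf, AddSubgroup.mem_iInf, AddMonoidHom.mem_ker,
      AddMonoidHom.sub_apply, AddMonoidHom.id_apply, sub_eq_zero]
  have hmem := galRes_mem_imprimitiveSelmer_iff hA hp hp2 hρ h hker S
  let φ : imprimitiveSelmer ρ S L →+ selmerInvariants ρ S L F :=
    ((galRes ρ h).comp (imprimitiveSelmer ρ S L).subtype).codRestrict _ fun c =>
      hinv.2 ⟨(hmem _).2 c.2, fun σ hσ => galConj_galRes_of_mem h hσ _⟩
  refine ⟨AddEquiv.ofBijective φ ⟨fun a b hab => ?_, fun c => ?_⟩, fun _ => rfl⟩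
  · exact Subtype.ext (galRes_injective hA hp hp2 hρ h hker (congrArg Subtype.val hab))
  · obtain ⟨hc, hc'⟩ := hinv.1 c.2
    obtain ⟨c', hc''⟩ := mem_range_galRes hA hp hp2 hρ h hker c.1 hc'
    refine ⟨⟨c', (hmem _).1 (hc''.symm ▸ hc)⟩, Subtype.ext hc''⟩

end Selmer

/-! ### Endomorphisms as rational functions of the `x`-coordinate -/

section XCoordinate

open Filter

namespace WeierstrassCurve.Affine.Point

variable {F : Type*} [Field F] {V : WeierstrassCurve.Affine F}

/-- `P` is an affine point with `x`-coordinate `x`. -/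
def HasX (P : V.Point) (x : F) : Prop := ∃ y h, P = .some x y h

lemma HasX.unique {P : V.Point} {x x' : F} (h : P.HasX x) (h' : P.HasX x') : x = x' := by
  obtain ⟨y, hy, rfl⟩ := h
  obtain ⟨y', hy', h'⟩ := h'
  exact (WeierstrassCurve.Affine.Point.some.inj h').1

lemma HasX.ne_zero {P : V.Point} {x : F} (h : P.HasX x) : P ≠ 0 := by
  obtain ⟨y, hy, rfl⟩ := h
  exact some_ne_zero hy

lemma HasX.neg {P : V.Point} {x : F} (h : P.HasX x) : (-P).HasX x := by
  obtain ⟨y, hy, rfl⟩ := h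
  exact ⟨_, _, neg_some hy⟩

lemma HasX.eq_or_eq_neg {P Q : V.Point} {x : F} (h : P.HasX x) (h' : Q.HasX x) : P = Q ∨ P = -Q := by
  obtain ⟨y, hy, rfl⟩ := h
  obtain ⟨y', hy', rfl⟩ := h'
  exact X_eq_iff.1 rfl

lemma exists_hasX_of_ne_zero {P : V.Point} (h : P ≠ 0) : ∃ x, P.HasX x := by
  obtain _ | ⟨x, y, hxy⟩ := P
  · exact absurd rfl h
  · exact ⟨x, y, hxy, rfl⟩

lemma exists_hasX [IsAlgClosed F] [V.IsElliptic] (x : F) : ∃ P : V.Point, P.HasX x := by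
  let q : Polynomial F := Polynomial.C 1 * Polynomial.X ^ 2
    + Polynomial.C (V.a₁ * x + V.a₃) * Polynomial.X
    + Polynomial.C (-(x ^ 3 + V.a₂ * x ^ 2 + V.a₄ * x + V.a₆))
  have hq : q.degree = 2 := Polynomial.degree_quadratic one_ne_zero
  obtain ⟨y, hy⟩ := IsAlgClosed.exists_root q (by rw [hq]; decide)
  refine ⟨.some x y (WeierstrassCurve.Affine.equation_iff_nonsingular.1 ?_), y, _, rfl⟩
  rw [WeierstrassCurve.Affine.equation_iff]
  simp only [Polynomial.IsRoot, q, Polynomial.eval_add, Polynomial.eval_mul, Polynomial.eval_C,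
    Polynomial.eval_pow, Polynomial.eval_X] at hy
  linear_combination hy

lemma ncard_hasX_le (x : F) : {P : V.Point | P.HasX x}.Finite ∧ {P : V.Point | P.HasX x}.ncard ≤ 2 := by
  by_cases h : ∃ P : V.Point, P.HasX x
  · obtain ⟨P, hP⟩ := h
    have hsub : {Q : V.Point | Q.HasX x} ⊆ {P, -P} := fun Q hQ => HasX.eq_or_eq_neg hQ hP
    exact ⟨(Set.toFinite _).subset hsub,
      (Set.ncard_le_ncard hsub (Set.toFinite _)).trans ((Set.ncard_insert_le _ _).trans (by rw [Set.ncard_singleton]))⟩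
  · have : {P : V.Point | P.HasX x} = ∅ := Set.eq_empty_of_forall_notMem fun P hP => h ⟨P, hP⟩
    simp [this]

lemma eventually_hasX {p : F → Prop} (h : ∀ᶠ x in cofinite, p x) :
    ∀ᶠ P : V.Point in cofinite, ∃ x, P.HasX x ∧ p x := by
  rw [eventually_cofinite] at h ⊢
  refine ((h.biUnion fun x _ => (ncard_hasX_le (V := V) x).1).insert 0).subset fun P hP => ?_
  by_cases h0 : P = 0
  · exact Or.inl h0
  obtain ⟨x, hx⟩ := exists_hasX_of_ne_zero h0
  refine Or.inr (Set.mem_biUnion (x := x) ?_ hx)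
  intro hpx
  exact hP ⟨x, hx, hpx⟩

lemma eventually_forall_hasX {p : V.Point → Prop} (h : ∀ᶠ P in cofinite, p P) :
    ∀ᶠ x in cofinite, ∀ P : V.Point, P.HasX x → p P := by
  classical
  rw [eventually_cofinite] at h ⊢
  refine (h.image fun P => if h : ∃ x, P.HasX x then h.choose else 0).subset fun x hx => ?_
  push Not at hx
  obtain ⟨P, hP, hpP⟩ := hx
  refine ⟨P, hpP, ?_⟩
  have hex : ∃ x, P.HasX x := ⟨x, hP⟩
  simp only [dif_pos hex]
  exact hex.choose_spec.unique hP

instance infinite_of_isElliptic [IsAlgClosed F] [V.IsElliptic] : Infinite V.Point := by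
  have : Infinite F := IsAlgClosed.instInfinite
  choose P hP using exists_hasX (V := V)
  exact Infinite.of_injective P fun x x' h => (hP x).unique (h ▸ hP x')

lemma eventually_eval_ne_zero {q : Polynomial F} (hq : q ≠ 0) : ∀ᶠ x in cofinite, q.eval x ≠ 0 := by
  classical
  rw [eventually_cofinite]
  refine q.roots.toFinset.finite_toSet.subset fun x hx => ?_
  simpa [hq] using hx

/-- On the curve, `(y - negY x y) ^ 2` equals `4x³ + b₂x² + 2b₄x + b₆`, a nonzero polynomial in `x`;
the exceptions are `0` and the `2`-torsion points. -/
lemma eventually_ne_negY [CharZero F] :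
    ∀ᶠ P : V.Point in cofinite, ∃ x y h, P = .some x y h ∧ y ≠ V.negY x y := by
  let q : Polynomial F := Polynomial.C 4 * Polynomial.X ^ 3 + Polynomial.C V.b₂ * Polynomial.X ^ 2
    + Polynomial.C (2 * V.b₄) * Polynomial.X + Polynomial.C V.b₆
  have hq : q ≠ 0 := by
    intro h
    have := Polynomial.degree_cubic (b := V.b₂) (c := 2 * V.b₄) (d := V.b₆) (show (4 : F) ≠ 0 by norm_num)
    change q.degree = 3 at this
    rw [h, Polynomial.degree_zero] at this
    exact absurd this (by decide)
  filter_upwards [eventually_hasX (V := V) (eventually_eval_ne_zero hq)] with P ⟨x, ⟨y, h, hP⟩, hx⟩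
  refine ⟨x, y, h, hP, fun hy => hx ?_⟩
  have h1 := (WeierstrassCurve.Affine.equation_iff _ _).1 h.1
  rw [WeierstrassCurve.Affine.negY] at hy
  simp only [q, Polynomial.eval_add, Polynomial.eval_mul, Polynomial.eval_C,
    Polynomial.eval_pow, Polynomial.eval_X, WeierstrassCurve.b₂, WeierstrassCurve.b₄, WeierstrassCurve.b₆]
  linear_combination (2 * y + V.a₁ * x + V.a₃) * hy - 4 * h1

variable [DecidableEq F]

/-- The endomorphism `φ` is given on `x`-coordinates by the rational function `r / s`, away from
finitely many points. -/
def IsXMap (φ : AddMonoid.End V.Point) (r s : Polynomial F) : Prop :=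
  IsCoprime r s ∧ ∀ᶠ P in cofinite, ∃ x, P.HasX x ∧ s.eval x ≠ 0 ∧ (φ P).HasX (r.eval x / s.eval x)

/-- The sum and product of the `x`-coordinates of `P + Q` and `P - Q` depend only on those of `P`
and `Q`. These identities are the source of the parallelogram law for degrees. If `u = v`, then `P =
±Q` and one of `P ± Q` would be zero. -/
lemma x_add_sub {P Q : V.Point} {u v U U' : F} (hP : P.HasX u) (hQ : Q.HasX v) (hU : (P + Q).HasX U)
    (hU' : (P - Q).HasX U') :
    u ≠ v ∧ (U + U') * (u - v) ^ 2 = 2 * u * v * (u + v) + V.b₂ * u * v + V.b₄ * (u + v) + V.b₆ ∧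
      U * U' * (u - v) ^ 2 = u ^ 2 * v ^ 2 - V.b₄ * u * v - V.b₆ * (u + v) - V.b₈ := by
  have huv : u ≠ v := by
    rintro rfl
    obtain rfl | rfl := hP.eq_or_eq_neg hQ
    · exact hU'.ne_zero (sub_self _)
    · exact hU.ne_zero (neg_add_cancel _)
  obtain ⟨y, h1, rfl⟩ := hP
  obtain ⟨z, h2, rfl⟩ := hQ
  rw [add_of_X_ne huv] at hU
  rw [sub_eq_add_neg, neg_some, add_of_X_ne huv] at hU'
  have e1 := hU.unique ⟨_, _, rfl⟩
  have e2 := hU'.unique ⟨_, _, rfl⟩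
  have hne : u - v ≠ 0 := sub_ne_zero.2 huv
  rw [WeierstrassCurve.Affine.slope_of_X_ne huv, WeierstrassCurve.Affine.addX] at e1 e2
  rw [WeierstrassCurve.Affine.negY] at e2
  have f1 : U * (u - v) ^ 2 = (y - z) ^ 2 + V.a₁ * (y - z) * (u - v) - (V.a₂ + u + v) * (u - v) ^ 2 := by
    rw [e1]
    field_simp
    ring
  have f2 : U' * (u - v) ^ 2 = (y - (-z - V.a₁ * v - V.a₃)) ^ 2
      + V.a₁ * (y - (-z - V.a₁ * v - V.a₃)) * (u - v) - (V.a₂ + u + v) * (u - v) ^ 2 := by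
    rw [e2]
    field_simp
    ring
  have g1 := (WeierstrassCurve.Affine.equation_iff _ _).1 h1.1
  have g2 := (WeierstrassCurve.Affine.equation_iff _ _).1 h2.1
  rw [WeierstrassCurve.b₂, WeierstrassCurve.b₄, WeierstrassCurve.b₆, WeierstrassCurve.b₈]
  generalize V.a₁ = a1 at *
  generalize V.a₂ = a2 at *
  generalize V.a₃ = a3 at *
  generalize V.a₄ = a4 at *
  generalize V.a₆ = a6 at *
  refine ⟨huv, ?_, ?_⟩
  · linear_combination f1 + f2 + 2 * g1 + 2 * g2
  · have : (u - v) ^ 2 ≠ 0 := pow_ne_zero _ hne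
    apply mul_right_cancel₀ this
    have e : U * U' * (u - v) ^ 2 * (u - v) ^ 2 = (U * (u - v) ^ 2) * (U' * (u - v) ^ 2) := by ring
    rw [e, f1, f2]
    clear e this f1 f2 huv e1 e2 hU hU' h1 h2 hne
    grind

lemma exists_isXMap_of_eval {φ : AddMonoid.End V.Point} {a b : Polynomial F} (hb : b ≠ 0)
    (h : ∀ᶠ P in cofinite, ∃ x x', P.HasX x ∧ (φ P).HasX x' ∧ a.eval x = x' * b.eval x) :
    ∃ r s, IsXMap φ r s := by
  classical
  have hg : EuclideanDomain.gcd a b ≠ 0 := fun h => hb (EuclideanDomain.gcd_eq_zero_iff.1 h).2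
  obtain ⟨r, hr⟩ := EuclideanDomain.gcd_dvd_left a b
  obtain ⟨s, hs⟩ := EuclideanDomain.gcd_dvd_right a b
  refine ⟨r, s, ?_, ?_⟩
  · have h1 := EuclideanDomain.gcd_eq_gcd_ab a b
    refine ⟨EuclideanDomain.gcdA a b, EuclideanDomain.gcdB a b, mul_left_cancel₀ hg ?_⟩
    linear_combination -EuclideanDomain.gcdA a b * hr - EuclideanDomain.gcdB a b * hs - h1
  · filter_upwards [h, eventually_hasX (V := V) (eventually_eval_ne_zero hb)] with P ⟨x, x', hx, hx', he⟩
      ⟨x1, hx1, hbx⟩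
    obtain rfl := hx.unique hx1
    rw [hs, Polynomial.eval_mul] at hbx
    have hgx := left_ne_zero_of_mul hbx
    have hsx := right_ne_zero_of_mul hbx
    refine ⟨x, hx, hsx, ?_⟩
    convert hx' using 1
    rw [div_eq_iff hsx]
    apply mul_left_cancel₀ hgx
    rw [← Polynomial.eval_mul, ← hr, he]
    conv_lhs => rw [hs]
    rw [Polynomial.eval_mul]
    ring

/-- If an endomorphism multiplies out to `f₀ + f₁ y = x' (d₀ + d₁ y)` then its `x`-coordinate is a
rational function of `x`. -/
lemma exists_isXMap_of_linear [CharZero F] [IsAlgClosed F] [V.IsElliptic] {φ : AddMonoid.End V.Point}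
    {f₀ f₁ d₀ d₁ : Polynomial F}
    (h : ∀ᶠ P in cofinite, ∃ x y x' h, P = .some x y h ∧ (φ P).HasX x' ∧
      d₀.eval x + d₁.eval x * y ≠ 0 ∧ f₀.eval x + f₁.eval x * y = x' * (d₀.eval x + d₁.eval x * y)) :
    ∃ r s, IsXMap φ r s := by
  have hneg : Tendsto (fun P : V.Point => -P) cofinite cofinite := neg_injective.tendsto_cofinite
  have h2 : ∀ᶠ P : V.Point in cofinite, ∃ x x', P.HasX x ∧ (φ P).HasX x' ∧
      f₀.eval x = x' * d₀.eval x ∧ f₁.eval x = x' * d₁.eval x := by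
    -- The points `φ P` and `φ (-P)` share their `x`-coordinate, so the relation holds for both `y`
    -- and `negY x y`. As these differ, the coefficients can be compared separately.
    filter_upwards [h, hneg.eventually h, eventually_ne_negY (V := V)] with P ⟨x, y, x', h, hP, hx', _, he⟩
      ⟨x1, y1, x1', h1, hP1, hx1', _, he1⟩ ⟨x2, y2, h2, hP2, hy2⟩
    rw [hP, neg_some] at hP1
    obtain ⟨rfl, rfl⟩ := WeierstrassCurve.Affine.Point.some.inj hP1
    obtain ⟨rfl, rfl⟩ := WeierstrassCurve.Affine.Point.some.inj (hP.symm.trans hP2)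
    rw [map_neg] at hx1'
    have hxx := hx1'.neg
    rw [neg_neg] at hxx
    obtain rfl := hx'.unique hxx
    have hsub : y - V.negY x y ≠ 0 := sub_ne_zero.2 hy2
    have e1 : f₁.eval x = x' * d₁.eval x := by
      apply mul_right_cancel₀ hsub
      linear_combination he - he1
    refine ⟨x, x', ⟨y, h, hP⟩, hx', ?_, e1⟩
    linear_combination he - y * e1
  by_cases hd : d₁ = 0
  · refine exists_isXMap_of_eval (a := f₀) (b := d₀) ?_ ?_
    · rintro rfl
      obtain ⟨P, x, y, x', -, -, -, hne, -⟩ := h.exists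
      simp [hd] at hne
    · filter_upwards [h2] with P ⟨x, x', a1, a2, a3, a4⟩
      exact ⟨x, x', a1, a2, a3⟩
  · refine exists_isXMap_of_eval (a := f₁) (b := d₁) hd ?_
    filter_upwards [h2] with P ⟨x, x', a1, a2, a3, a4⟩
    exact ⟨x, x', a1, a2, a4⟩

end WeierstrassCurve.Affine.Point

open WeierstrassCurve.Affine.Point

/-- The Weierstrass equation replaces `y ^ 2`, so functions on the affine curve are spanned by `1`
and `y` over polynomials in `x`. -/
lemma exists_aeval_eq_linear {K : Type*} [Field K] {F : Type*} [Field F] [Algebra K F]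
    (V : WeierstrassCurve.Affine F) (q : MvPolynomial (Fin 2) K) :
    ∃ q₀ q₁ : Polynomial F, ∀ x y, V.Equation x y →
      MvPolynomial.aeval ![x, y] q = q₀.eval x + q₁.eval x * y := by
  induction q using MvPolynomial.induction_on with
  | C a => exact ⟨Polynomial.C (algebraMap K F a), 0, fun x y _ => by simp⟩
  | add f g hf hg =>
    obtain ⟨f₀, f₁, hf⟩ := hf
    obtain ⟨g₀, g₁, hg⟩ := hg
    refine ⟨f₀ + g₀, f₁ + g₁, fun x y h => ?_⟩
    rw [map_add, hf x y h, hg x y h, Polynomial.eval_add, Polynomial.eval_add]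
    ring
  | mul_X f i hf =>
    obtain ⟨f₀, f₁, hf⟩ := hf
    fin_cases i
    · refine ⟨f₀ * Polynomial.X, f₁ * Polynomial.X, fun x y h => ?_⟩
      rw [map_mul, hf x y h, MvPolynomial.aeval_X]
      simp
      ring
    · refine ⟨f₁ * (Polynomial.X ^ 3 + Polynomial.C V.a₂ * Polynomial.X ^ 2
        + Polynomial.C V.a₄ * Polynomial.X + Polynomial.C V.a₆),
        f₀ - f₁ * (Polynomial.C V.a₁ * Polynomial.X + Polynomial.C V.a₃), fun x y h => ?_⟩
      rw [map_mul, hf x y h, MvPolynomial.aeval_X]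
      simp
      linear_combination f₁.eval x * (WeierstrassCurve.Affine.equation_iff _ _).1 h

lemma IsEndomorphism.exists_isXMap {K : Type u} [Field K] {W : WeierstrassCurve.Affine K} {Kbar : Type v}
    [Field Kbar] [Algebra K Kbar] [DecidableEq Kbar] [CharZero Kbar] [IsAlgClosed Kbar] [W.IsElliptic]
    {φ : AddMonoid.End (W.baseChange Kbar).Point} (hφ : IsEndomorphism W Kbar φ) (h0 : φ ≠ 0) :
    ∃ r s, IsXMap φ r s := by
  obtain h | ⟨f, g, d, hfin⟩ := hφ
  · exact absurd h h0
  obtain ⟨f₀, f₁, hf⟩ := exists_aeval_eq_linear (W.baseChange Kbar) f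
  obtain ⟨d₀, d₁, hd⟩ := exists_aeval_eq_linear (W.baseChange Kbar) d
  refine exists_isXMap_of_linear (f₀ := f₀) (f₁ := f₁) (d₀ := d₀) (d₁ := d₁) ?_
  have h1 : ∀ᶠ P in cofinite, IsGivenBy f g d φ P := hfin
  filter_upwards [h1] with P ⟨x, y, h, hP, hne, h', hφP⟩
  rw [hd x y h.1] at hne
  refine ⟨x, y, _, h, hP, ⟨_, _, hφP⟩, hne, ?_⟩
  rw [hd x y h.1, hf x y h.1, div_mul_cancel₀ _ hne]

end XCoordinate

/-! ### Degrees of the `x`-coordinate maps -/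

section XMap

open Filter Polynomial

namespace WeierstrassCurve.Affine.Point

variable {F : Type*} [Field F]

/-- The degree of the rational function `r / s` in lowest terms. -/
noncomputable def ratDegree (r s : F[X]) : ℕ := max r.natDegree s.natDegree

lemma natDegree_sub_C_mul_le (r s : F[X]) (c : F) : (r - C c * s).natDegree ≤ ratDegree r s :=
  (natDegree_sub_le _ _).trans (max_le_max le_rfl (natDegree_C_mul_le _ _))

/-- In positive degree `n`, the coefficient `r_n - c * s_n` vanishes for at most one `c`, because
`r_n` and `s_n` are not both zero. This counts generic fibres of `r / s`. -/
lemma eventually_natDegree_sub (r s : F[X]) :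
    ∀ᶠ c in cofinite, (r - C c * s).natDegree = ratDegree r s := by
  obtain h0 | h0 := Nat.eq_zero_or_pos (ratDegree r s)
  · refine Eventually.of_forall fun c => ?_
    have := natDegree_sub_C_mul_le r s c
    omega
  set n := ratDegree r s with hn
  have hq : (C (r.coeff n) - X * C (s.coeff n) : F[X]) ≠ 0 := by
    intro h
    have e0 := congrArg (coeff · 0) h
    have e1 := congrArg (coeff · 1) h
    simp [coeff_C] at e0 e1
    obtain h1 | h1 := max_choice r.natDegree s.natDegree
    · have h2 : n = r.natDegree := h1
      rw [h2, coeff_natDegree, leadingCoeff_eq_zero] at e0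
      rw [h2, e0, natDegree_zero] at h0
      exact lt_irrefl _ h0
    · have h2 : n = s.natDegree := h1
      rw [h2, coeff_natDegree, leadingCoeff_eq_zero] at e1
      rw [h2, e1, natDegree_zero] at h0
      exact lt_irrefl _ h0
  filter_upwards [eventually_eval_ne_zero hq] with c hc
  refine le_antisymm (natDegree_sub_C_mul_le r s c) (le_natDegree_of_ne_zero ?_)
  simpa [mul_comm c] using hc

variable {r s r₁ s₁ r₂ s₂ R S R' S' : F[X]}

lemma eq_of_eventually_eval [Infinite F] {a b : F[X]} (h : ∀ᶠ x in cofinite, a.eval x = b.eval x) :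
    a = b := by
  by_contra hne
  obtain ⟨x, hx, hx'⟩ := (h.and (eventually_eval_ne_zero (sub_ne_zero.2 hne))).exists
  exact hx' (by rw [eval_sub, hx, sub_self])

/-- Nothing cancels jointly from `S * S'`, `R * R'` and `R * S' + R' * S`. Indeed `R * S'` and `R' *
S` are the roots of a quadratic with these coefficients, so their squares times `D` are divisible by
`S * S'`. Squaring the product of the two Bézout relations writes `1` in terms of these squares, `R
* R'` and `S * S'`. -/
lemma mul_dvd_of_isCoprime {A : Type*} [CommRing A] {R S R' S' D s p : A} (h : IsCoprime R S)
    (h' : IsCoprime R' S') (hs : (R * S' + R' * S) * D = s * (S * S'))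
    (hp : R * R' * D = p * (S * S')) : S * S' ∣ D := by
  obtain ⟨a, b, hab⟩ := h
  obtain ⟨a', b', hab'⟩ := h'
  have h1 : (R * S') ^ 2 * D = S * S' * (R * S' * s - p * (S * S')) := by
    linear_combination (R * S') * hs - (S * S') * hp
  have h2 : (R' * S) ^ 2 * D = S * S' * (R' * S * s - p * (S * S')) := by
    linear_combination (R' * S) * hs - (S * S') * hp
  have h3 : D = ((a * R + b * S) * (a' * R' + b' * S')) ^ 2 * D := by rw [hab, hab']; ring
  have h4 : ((a * R + b * S) * (a' * R' + b' * S')) ^ 2 =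
      (R * R') * (a ^ 2 * a' ^ 2 * R * R' + 2 * a * a' * (a * b' * R * S' + b * a' * S * R')) +
      (a * b') ^ 2 * (R * S') ^ 2 + (b * a') ^ 2 * (R' * S) ^ 2 +
      S * S' * ((b * b') ^ 2 * S * S' + 2 * a * a' * b * b' * R * R' * 2 +
        2 * b * b' * (a * b' * R * S' + b * a' * S * R')) := by ring
  rw [h3, h4, add_mul, add_mul, add_mul]
  refine dvd_add (dvd_add (dvd_add ?_ ?_) ?_) ?_
  · exact ⟨p * (a ^ 2 * a' ^ 2 * R * R' + 2 * a * a' * (a * b' * R * S' + b * a' * S * R')), by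
      linear_combination (a ^ 2 * a' ^ 2 * R * R' + 2 * a * a' * (a * b' * R * S' + b * a' * S * R')) * hp⟩
  · rw [mul_assoc, h1]
    exact (Dvd.intro _ rfl).mul_left _
  · rw [mul_assoc, h2]
    exact (Dvd.intro _ rfl).mul_left _
  · exact (Dvd.intro _ rfl).mul_right _

/-- Every term is homogeneous of degree two in `(r₁, s₁)` and of degree two in `(r₂, s₂)`. -/
lemma natDegree_le_of_parallelogram {h₁ h₂ : ℕ} (b₂ b₄ b₆ b₈ c : F) (hr₁ : r₁.natDegree ≤ h₁)
    (hs₁ : s₁.natDegree ≤ h₁) (hr₂ : r₂.natDegree ≤ h₂) (hs₂ : s₂.natDegree ≤ h₂) :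
    ((r₁ ^ 2 * r₂ ^ 2 - C b₄ * (r₁ * r₂ * s₁ * s₂) - C b₆ * ((r₁ * s₂ + r₂ * s₁) * (s₁ * s₂))
      - C b₈ * (s₁ ^ 2 * s₂ ^ 2)) -
      C c * (2 * (r₁ * r₂ * (r₁ * s₂ + r₂ * s₁)) + C b₂ * (r₁ * r₂ * s₁ * s₂)
        + C b₄ * ((r₁ * s₂ + r₂ * s₁) * (s₁ * s₂)) + C b₆ * (s₁ ^ 2 * s₂ ^ 2)) +
      C (c ^ 2) * (r₁ * s₂ - r₂ * s₁) ^ 2).natDegree ≤ 2 * (h₁ + h₂) := by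
  have hC (a : F) : (C a).natDegree ≤ 0 := (natDegree_C a).le
  have h2 : (2 : F[X]).natDegree ≤ 0 := (natDegree_ofNat 2).le
  have m {f g : F[X]} {a b c : ℕ} (hf : f.natDegree ≤ a) (hg : g.natDegree ≤ b) (h : a + b ≤ c) :
      (f * g).natDegree ≤ c := natDegree_mul_le.trans ((add_le_add hf hg).trans h)
  have q {f : F[X]} {a c : ℕ} (hf : f.natDegree ≤ a) (h : 2 * a ≤ c) : (f ^ 2).natDegree ≤ c :=
    natDegree_pow_le.trans ((Nat.mul_le_mul_left 2 hf).trans h)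
  have t : (r₁ * s₂ + r₂ * s₁).natDegree ≤ h₁ + h₂ :=
    natDegree_add_le_of_degree_le (m hr₁ hs₂ le_rfl) (m hr₂ hs₁ (by omega))
  have hd : (r₁ * s₂ - r₂ * s₁).natDegree ≤ h₁ + h₂ :=
    natDegree_sub_le_of_le (m hr₁ hs₂ le_rfl) (m hr₂ hs₁ (by omega)) |>.trans (max_self _).le
  have hss : (s₁ * s₂).natDegree ≤ h₁ + h₂ := m hs₁ hs₂ le_rfl
  have hrr : (r₁ * r₂).natDegree ≤ h₁ + h₂ := m hr₁ hr₂ le_rfl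
  have hrrss : (r₁ * r₂ * s₁ * s₂).natDegree ≤ 2 * (h₁ + h₂) :=
    m (m hrr hs₁ le_rfl) hs₂ (by omega)
  have hs4 : (s₁ ^ 2 * s₂ ^ 2).natDegree ≤ 2 * (h₁ + h₂) := m (q hs₁ le_rfl) (q hs₂ le_rfl) (by omega)
  have hr4 : (r₁ ^ 2 * r₂ ^ 2).natDegree ≤ 2 * (h₁ + h₂) := m (q hr₁ le_rfl) (q hr₂ le_rfl) (by omega)
  have hts : ((r₁ * s₂ + r₂ * s₁) * (s₁ * s₂)).natDegree ≤ 2 * (h₁ + h₂) := m t hss (by omega)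
  have htr : (r₁ * r₂ * (r₁ * s₂ + r₂ * s₁)).natDegree ≤ 2 * (h₁ + h₂) := m hrr t (by omega)
  have sub {f g : F[X]} {n : ℕ} (hf : f.natDegree ≤ n) (hg : g.natDegree ≤ n) :
      (f - g).natDegree ≤ n := (natDegree_sub_le_of_le hf hg).trans (max_self _).le
  have cm (a : F) {f : F[X]} {n : ℕ} (hf : f.natDegree ≤ n) : (C a * f).natDegree ≤ n :=
    m (hC a) hf (by omega)
  refine natDegree_add_le_of_degree_le (sub (sub (sub (sub hr4 (cm _ hrrss)) (cm _ hts)) (cm _ hs4))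
    (cm _ ?_)) (cm _ (q hd le_rfl))
  exact natDegree_add_le_of_degree_le (natDegree_add_le_of_degree_le (natDegree_add_le_of_degree_le
    (m h2 htr (by omega)) (cm _ hrrss)) (cm _ hts)) (cm _ hs4)

variable [DecidableEq F] {V : WeierstrassCurve.Affine F} {φ ψ : AddMonoid.End V.Point}

/-- A constant `x`-coordinate map would give `φ` finite image, and the order of that image would
annihilate `φ`. -/
lemma IsXMap.ratDegree_pos (hφ : IsXMap φ r s) (htf : ∀ N : ℕ, 0 < N → N • φ ≠ 0) :
    0 < ratDegree r s := by
  by_contra! h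
  have hr : r = C (r.coeff 0) := eq_C_of_natDegree_le_zero ((le_max_left _ _).trans h)
  have hs : s = C (s.coeff 0) := eq_C_of_natDegree_le_zero ((le_max_right _ _).trans h)
  have hfin : ((AddMonoidHom.range (φ : V.Point →+ V.Point) : AddSubgroup V.Point) : Set V.Point).Finite := by
    refine ((ncard_hasX_le (V := V) (r.coeff 0 / s.coeff 0)).1.union
      (Set.Finite.image φ (eventually_cofinite.1 hφ.2))).subset ?_
    rintro _ ⟨P, rfl⟩
    by_cases hP : ∃ x, P.HasX x ∧ s.eval x ≠ 0 ∧ (φ P).HasX (r.eval x / s.eval x)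
    · obtain ⟨x, -, -, hx⟩ := hP
      rw [hr, hs, eval_C, eval_C] at hx
      exact Or.inl hx
    · exact Or.inr ⟨P, hP, rfl⟩
  have : Finite (AddMonoidHom.range (φ : V.Point →+ V.Point)) := hfin.to_subtype
  refine htf (Nat.card (AddMonoidHom.range (φ : V.Point →+ V.Point))) Nat.card_pos ?_
  ext1 P
  have h1 := card_nsmul_eq_zero' (x := (⟨φ P, P, rfl⟩ : AddMonoidHom.range (φ : V.Point →+ V.Point)))
  exact congrArg Subtype.val h1

lemma eq_top_of_finite_compl {G : Type*} [AddGroup G] [Infinite G] {H : AddSubgroup G}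
    (hH : ((H : Set G)ᶜ).Finite) : H = ⊤ := by
  by_contra hne
  obtain ⟨P, hP⟩ : ∃ P, P ∉ H := by
    by_contra! h
    exact hne ((AddSubgroup.eq_top_iff' H).2 h)
  have hHinf : (H : Set G).Infinite := by
    intro hfin
    exact Set.infinite_univ (by simpa using hfin.union hH)
  refine (hHinf.image (f := fun Q => P + Q) (fun a _ b _ hab => add_left_cancel hab)) (hH.subset ?_)
  rintro _ ⟨Q, hQ, rfl⟩ hmem
  exact hP ((H.add_mem_cancel_right hQ).1 hmem)

/-- For generic `c` the equation `r = c * s` has a root, so both points above `c` lie in the image.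
The image is then a subgroup with finite complement in an infinite group, hence everything. -/
lemma IsXMap.surjective [IsAlgClosed F] [V.IsElliptic] (hφ : IsXMap φ r s)
    (htf : ∀ N : ℕ, 0 < N → N • φ ≠ 0) : Function.Surjective φ := by
  have hpos := hφ.ratDegree_pos htf
  have hbad := eventually_cofinite.1 (eventually_forall_hasX hφ.2)
  have hgood : ∀ᶠ c in cofinite, ∀ P : V.Point, P.HasX c → P ∈ AddMonoidHom.range (φ : V.Point →+ V.Point) := by
    have h1 : ∀ᶠ c in cofinite, c ∉ (fun x => r.eval x / s.eval x) '' _ :=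
      (hbad.image (fun x => r.eval x / s.eval x)).eventually_cofinite_notMem
    filter_upwards [h1, eventually_natDegree_sub r s] with c hc hdeg Q hQ
    obtain ⟨x, hx⟩ := IsAlgClosed.exists_root (r - C c * s)
      (fun h => by
        rw [natDegree_eq_of_degree_eq_some (n := 0) h] at hdeg
        omega)
    have hx' : r.eval x = c * s.eval x := by simpa [IsRoot, sub_eq_zero] using hx
    have hsx : s.eval x ≠ 0 := by
      intro h0
      obtain ⟨a, b, hab⟩ := hφ.1
      have := congrArg (eval x) hab
      simp [h0, hx'] at this
    obtain ⟨P, hP⟩ := exists_hasX (V := V) x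
    have hgx : ∀ P : V.Point, P.HasX x →
        ∃ x, P.HasX x ∧ s.eval x ≠ 0 ∧ (φ P).HasX (r.eval x / s.eval x) := by
      by_contra hb
      exact hc ⟨x, hb, by simp only; rw [hx', mul_div_cancel_right₀ _ hsx]⟩
    obtain ⟨x', hPx', -, hφP⟩ := hgx P hP
    obtain rfl := hP.unique hPx'
    rw [hx', mul_div_cancel_right₀ _ hsx] at hφP
    obtain rfl | rfl := hQ.eq_or_eq_neg hφP
    · exact ⟨P, rfl⟩
    · exact neg_mem ⟨P, rfl⟩
  have htop : AddMonoidHom.range (φ : V.Point →+ V.Point) = ⊤ := by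
    refine eq_top_of_finite_compl ?_
    have := eventually_hasX (V := V) hgood
    refine (eventually_cofinite.1 this).subset fun P hP h => ?_
    obtain ⟨x, hx, h'⟩ := h
    exact hP (h' P hx)
  exact AddMonoidHom.range_eq_top.1 htop

/-- The kernel is a translate of a generic fibre, whose `x`-coordinates are roots of `r - c * s`,
with at most two points over each. -/
lemma IsXMap.ncard_ker_le [IsAlgClosed F] [V.IsElliptic] (hφ : IsXMap φ r s)
    (hsurj : Function.Surjective φ) (hpos : 0 < ratDegree r s) :
    {P | φ P = 0}.Finite ∧ {P | φ P = 0}.ncard ≤ 2 * ratDegree r s := by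
  classical
  have h1 : ∀ᶠ Q in cofinite, Q ∉ φ '' _ :=
    ((eventually_cofinite.1 hφ.2).image φ).eventually_cofinite_notMem
  obtain ⟨Q, hQ, c, hc, hdeg⟩ := (h1.and (eventually_hasX (V := V) (eventually_natDegree_sub r s))).exists
  obtain ⟨P₀, hP₀⟩ := hsurj Q
  have hne : r - C c * s ≠ 0 := by
    intro h
    rw [h, natDegree_zero] at hdeg
    omega
  have hsub : (fun P => P₀ + P) '' {P | φ P = 0} ⊆
      ⋃ x ∈ (r - C c * s).roots.toFinset, {P : V.Point | P.HasX x} := by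
    rintro _ ⟨P, hP, rfl⟩
    have hφP : φ (P₀ + P) = Q := by rw [map_add, hP₀, show φ P = 0 from hP, add_zero]
    have hgood : ∃ x, (P₀ + P).HasX x ∧ s.eval x ≠ 0 ∧ (φ (P₀ + P)).HasX (r.eval x / s.eval x) := by
      by_contra hb
      exact hQ ⟨_, hb, hφP⟩
    obtain ⟨x, hx, hsx, hx'⟩ := hgood
    rw [hφP] at hx'
    have hcx := hc.unique hx'
    refine Set.mem_biUnion (x := x) ?_ hx
    simp only [Multiset.mem_toFinset, Finset.mem_coe, mem_roots hne, IsRoot, eval_sub, eval_mul, eval_C]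
    rw [hcx, div_mul_cancel₀ _ hsx, sub_self]
  have hfin : (⋃ x ∈ (r - C c * s).roots.toFinset, {P : V.Point | P.HasX x}).Finite :=
    Set.Finite.biUnion (Finset.finite_toSet _) fun x _ => (ncard_hasX_le x).1
  have hinj : Set.InjOn (fun P => P₀ + P) {P | φ P = 0} := fun a _ b _ h => add_left_cancel h
  refine ⟨Set.Finite.of_finite_image (hfin.subset hsub) hinj, ?_⟩
  rw [← hinj.ncard_image]
  refine (Set.ncard_le_ncard hsub hfin).trans ?_
  refine (Finset.set_ncard_biUnion_le _ _).trans ?_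
  refine (Finset.sum_le_card_nsmul _ _ 2 fun x _ => (ncard_hasX_le x).2).trans ?_
  rw [smul_eq_mul, mul_comm]
  refine Nat.mul_le_mul_left 2 ((Multiset.toFinset_card_le _).trans ((card_roots' _).trans hdeg.le))

/-- One half of the parallelogram law for the degrees of endomorphisms. -/
theorem IsXMap.ratDegree_add_le [IsAlgClosed F] [V.IsElliptic] (h₁ : IsXMap φ r₁ s₁)
    (h₂ : IsXMap ψ r₂ s₂) (h : IsXMap (φ + ψ) R S) (h' : IsXMap (φ - ψ) R' S') :
    ratDegree R S + ratDegree R' S' ≤ 2 * (ratDegree r₁ s₁ + ratDegree r₂ s₂) := by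
  have : Infinite F := IsAlgClosed.instInfinite
  -- `D`, `Sm` and `Pr` are the denominator and the two numerators in `x_add_sub`, homogenized with
  -- `u = r₁ / s₁` and `v = r₂ / s₂`.
  obtain ⟨D, hD⟩ : ∃ D, D = (r₁ * s₂ - r₂ * s₁) ^ 2 := ⟨_, rfl⟩
  obtain ⟨Sm, hSm⟩ : ∃ Sm, Sm = 2 * (r₁ * r₂ * (r₁ * s₂ + r₂ * s₁)) + C V.b₂ * (r₁ * r₂ * s₁ * s₂)
        + C V.b₄ * ((r₁ * s₂ + r₂ * s₁) * (s₁ * s₂)) + C V.b₆ * (s₁ ^ 2 * s₂ ^ 2) := ⟨_, rfl⟩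
  obtain ⟨Pr, hPr⟩ : ∃ Pr, Pr = r₁ ^ 2 * r₂ ^ 2 - C V.b₄ * (r₁ * r₂ * s₁ * s₂)
      - C V.b₆ * ((r₁ * s₂ + r₂ * s₁) * (s₁ * s₂)) - C V.b₈ * (s₁ ^ 2 * s₂ ^ 2) := ⟨_, rfl⟩
  have key : ∀ᶠ x in cofinite, D.eval x ≠ 0 ∧
      ((R * S' + R' * S) * D).eval x = (Sm * (S * S')).eval x ∧
      (R * R' * D).eval x = (Pr * (S * S')).eval x := by
    have h5 : ∀ᶠ P : V.Point in cofinite, ∀ x, P.HasX x → D.eval x ≠ 0 ∧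
      ((R * S' + R' * S) * D).eval x = (Sm * (S * S')).eval x ∧
      (R * R' * D).eval x = (Pr * (S * S')).eval x := by
      filter_upwards [h₁.2, h₂.2, h.2, h'.2] with P ⟨x, hx, a1, a2⟩ ⟨x2, hx2, b1, b2⟩
        ⟨x3, hx3, c1, c2⟩ ⟨x4, hx4, d1, d2⟩ x5 hx5
      obtain rfl := hx.unique hx2
      obtain rfl := hx.unique hx3
      obtain rfl := hx.unique hx4
      obtain rfl := hx.unique hx5
      obtain ⟨e1, e2, e3⟩ := x_add_sub a2 b2 c2 d2
      rw [hD, hSm, hPr]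
      simp only [eval_mul, eval_add, eval_sub, eval_pow, eval_C, eval_ofNat]
      generalize r₁.eval x = ρ₁ at *
      generalize s₁.eval x = σ₁ at *
      generalize r₂.eval x = ρ₂ at *
      generalize s₂.eval x = σ₂ at *
      generalize R.eval x = T at *
      generalize S.eval x = U at *
      generalize R'.eval x = T' at *
      generalize S'.eval x = U' at *
      refine ⟨?_, ?_, ?_⟩
      · intro h0
        apply e1
        rw [div_eq_div_iff a1 b1]
        exact sub_eq_zero.1 (pow_eq_zero_iff (two_ne_zero)|>.1 h0)
      · field_simp at e2
        linear_combination e2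
      · field_simp at e3
        linear_combination e3
    filter_upwards [eventually_forall_hasX h5] with x hx
    obtain ⟨P, hP⟩ := exists_hasX (V := V) x
    exact hx P hP x hP
  have hD0 : D ≠ 0 := by
    rintro rfl
    obtain ⟨x, hx, -⟩ := key.exists
    exact hx eval_zero
  have k1 : (R * S' + R' * S) * D = Sm * (S * S') := eq_of_eventually_eval (key.mono fun x hx => hx.2.1)
  have k2 : R * R' * D = Pr * (S * S') := eq_of_eventually_eval (key.mono fun x hx => hx.2.2)
  obtain ⟨g, hg⟩ := mul_dvd_of_isCoprime h.1 h'.1 k1 k2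
  have hSS : S * S' ≠ 0 := by
    intro h0
    rw [h0, zero_mul] at hg
    exact hD0 hg
  have hg0 : g ≠ 0 := by
    rintro rfl
    rw [mul_zero] at hg
    exact hD0 hg
  have k3 : Sm = (R * S' + R' * S) * g := by
    apply mul_right_cancel₀ hSS
    rw [← k1, hg]
    ring
  have k4 : Pr = R * R' * g := by
    apply mul_right_cancel₀ hSS
    rw [← k2, hg]
    ring
  -- For generic `c`, the factors `R - c * S` and `R' - c * S'` have full degree, and `g` times
  -- their product is `Pr - c * Sm + c ^ 2 * D`, of degree at most the right-hand side.
  obtain ⟨c, ⟨hc1, hc2⟩, hc0, hc0'⟩ := (((eventually_natDegree_sub R S).and (eventually_natDegree_sub R' S')).and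
    (show ∀ᶠ c in cofinite, R - C c * S ≠ 0 ∧ R' - C c * S' ≠ 0 by
      have aux {R S : F[X]} (hS : S ≠ 0) : ∀ᶠ c in cofinite, R - C c * S ≠ 0 := by
        obtain ⟨x, hx⟩ := (eventually_eval_ne_zero hS).exists
        have hne : (C (R.eval x) - X * C (S.eval x) : F[X]) ≠ 0 := by
          intro h0
          have := congrArg (coeff · 1) h0
          simp [coeff_C] at this
          exact hx this
        filter_upwards [eventually_eval_ne_zero hne] with c hc h0
        apply hc
        have := congrArg (eval x) h0
        simpa [mul_comm c] using this
      exact (aux (left_ne_zero_of_mul hSS)).and (aux (right_ne_zero_of_mul hSS)))).exists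
  have hprod : (R - C c * S) * (R' - C c * S') * g = Pr - C c * Sm + C (c ^ 2) * D := by
    rw [k3, k4, hg, C_pow]
    ring
  have hle := natDegree_le_of_parallelogram V.b₂ V.b₄ V.b₆ V.b₈ c (le_max_left r₁.natDegree s₁.natDegree)
    (le_max_right _ _) (le_max_left r₂.natDegree s₂.natDegree) (le_max_right _ _)
  rw [← hD, ← hSm, ← hPr, ← hprod, natDegree_mul (mul_ne_zero hc0 hc0') hg0, natDegree_mul hc0 hc0', hc1,
    hc2] at hle
  exact (Nat.le_add_right _ _).trans hle

end WeierstrassCurve.Affine.Point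

end XMap

/-! ### Kernels of powers and quadratic growth -/

section Growth

/-- With a set-theoretic section `l` of `f`, the map `(x, y) ↦ x + l y` embeds `ker f × ker (f ^ n)`
into `ker (f ^ (n + 1))`. -/
lemma card_ker_pow_le {A : Type*} [AddCommGroup A] {f : AddMonoid.End A} (hf : Function.Surjective f)
    (n : ℕ) (hfin : ∀ n : ℕ, Finite {x // (f ^ n) x = 0}) :
    Nat.card {x // f x = 0} ^ n ≤ Nat.card {x // (f ^ n) x = 0} := by
  induction n with
  | zero =>
    have : Nonempty {x // (f ^ 0) x = 0} := ⟨⟨0, map_zero _⟩⟩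
    rw [pow_zero]
    exact Nat.one_le_iff_ne_zero.2 Nat.card_pos.ne'
  | succ n ih =>
    have := hfin (n + 1)
    have hs (x : A) : (f ^ (n + 1)) x = (f ^ n) (f x) := by rw [pow_succ]; rfl
    choose l hl using hf
    rw [pow_succ, mul_comm]
    refine (Nat.mul_le_mul_left _ ih).trans ?_
    rw [← Nat.card_prod]
    refine Nat.card_le_card_of_injective (fun xy => ⟨xy.1.1 + l xy.2.1, ?_⟩) ?_
    · rw [hs, map_add, hl, xy.1.2, zero_add, xy.2.2]
    · rintro ⟨⟨x, hx⟩, y, hy⟩ ⟨⟨x', hx'⟩, y', hy'⟩ h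
      have h1 : x + l y = x' + l y' := congrArg Subtype.val h
      have h2 := congrArg f h1
      rw [map_add, map_add, hx, hx', hl, hl, zero_add, zero_add] at h2
      subst h2
      obtain rfl := add_right_cancel h1
      rfl

lemma le_of_forall_pow_le {a b : ℕ} {C : ℝ} (hb : 0 < b) (h : ∀ n : ℕ, (a : ℝ) ^ n ≤ C * (b : ℝ) ^ n) :
    a ≤ b := by
  by_contra! hab
  have hb' : (0 : ℝ) < b := by exact_mod_cast hb
  have h1 : (1 : ℝ) < a / b := by
    rw [one_lt_div hb']
    exact_mod_cast hab
  obtain ⟨n, hn⟩ := pow_unbounded_of_one_lt C h1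
  rw [div_pow, lt_div_iff₀ (pow_pos hb' n)] at hn
  exact absurd (h n) (not_le.2 hn)

/-- A function satisfying half of the parallelogram law away from zero. -/
def IsSubParallelogram {G : Type*} [AddCommGroup G] (h : G → ℕ) : Prop :=
  h 0 = 0 ∧ ∀ a b, a ≠ 0 → b ≠ 0 → a + b ≠ 0 → a - b ≠ 0 → h (a + b) + h (a - b) ≤ 2 * (h a + h b)

variable {G : Type*} [AddCommGroup G] [IsAddTorsionFree G] {h : G → ℕ}

/-- The law for `(n + 2) • a` and `a` bounds second differences by `2 * h a`. It says nothing about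
`a` and `a`, as `a - a = 0`; therefore `h (2 • a)` enters as a second initial value. -/
lemma IsSubParallelogram.nsmul_le (hh : IsSubParallelogram h) {a : G} (ha : a ≠ 0) (n : ℕ) :
    h (n • a) ≤ (h a + h (2 • a)) * n ^ 2 := by
  have hstep : ∀ n : ℕ, (h ((n + 2) • a) : ℤ) ≤ h ((n + 1) • a) + h (2 • a) + 2 * n * h a := by
    intro n
    induction n with
    | zero => simp
    | succ n ih =>
      have h1 := hh.2 ((n + 2) • a) a (smul_ne_zero (by omega) ha) ha
        (by rw [← succ_nsmul]; exact smul_ne_zero (by omega) ha)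
        (by rw [succ_nsmul, add_sub_cancel_right]; exact smul_ne_zero (by omega) ha)
      rw [← succ_nsmul, succ_nsmul _ (n + 1), add_sub_cancel_right, ← succ_nsmul] at h1
      have h2 : (h ((n + 1 + 2) • a) : ℤ) + h ((n + 1) • a) ≤ 2 * (h ((n + 1 + 1) • a) + h a) := by
        exact_mod_cast h1
      have h3 : (n + 1 + 1) • a = (n + 2) • a := rfl
      rw [h3] at h2 ⊢
      push_cast
      linarith
  have hbound : ∀ n : ℕ, (h ((n + 1) • a) : ℤ) ≤ n * h (2 • a) + (n + 1) ^ 2 * h a := by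
    intro n
    induction n with
    | zero => simp
    | succ n ih =>
      have := hstep n
      have h3 : (n + 1 + 1) • a = (n + 2) • a := rfl
      rw [h3]
      push_cast
      have h0 : (0 : ℤ) ≤ h a := Int.natCast_nonneg _
      nlinarith
  obtain _ | n := n
  · rw [zero_smul, hh.1]
    exact Nat.zero_le _
  · have h1 : (h ((n + 1) • a) : ℤ) ≤ (h a + h (2 • a)) * (n + 1) ^ 2 := by
      have h0 : (0 : ℤ) ≤ h (2 • a) := Int.natCast_nonneg _
      have h2 : (n : ℤ) * h (2 • a) ≤ (n + 1) ^ 2 * h (2 • a) := by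
        refine mul_le_mul_of_nonneg_right ?_ h0
        nlinarith
      linarith [hbound n]
    exact_mod_cast h1

lemma IsSubParallelogram.exists_zsmul_le (hh : IsSubParallelogram h) {a : G} (ha : a ≠ 0) :
    ∃ C : ℕ, ∀ n : ℤ, (h (n • a) : ℤ) ≤ C * n ^ 2 := by
  -- Evenness of `h` is not assumed, so `a` and `-a` are bounded separately.
  refine ⟨max (h a + h (2 • a)) (h (-a) + h (2 • (-a))), fun n => ?_⟩
  have key : ∀ (b : G) (_ : b ≠ 0) (m : ℕ) (C : ℕ) (_ : h b + h (2 • b) ≤ C),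
      (h (m • b) : ℤ) ≤ C * (m : ℤ) ^ 2 := by
    intro b hb m C hC
    exact_mod_cast (hh.nsmul_le hb m).trans (Nat.mul_le_mul_right _ hC)
  obtain ⟨m, rfl | rfl⟩ := Int.eq_nat_or_neg n
  · rw [natCast_zsmul]
    exact key a ha m _ (le_max_left _ _)
  · rw [neg_smul, natCast_zsmul, ← smul_neg, neg_sq]
    exact key (-a) (neg_ne_zero.2 ha) m _ (le_max_right _ _)

lemma IsSubParallelogram.exists_zsmul_add_zsmul_le (hh : IsSubParallelogram h) {b : Fin 2 → G}
    (hb : LinearIndependent ℤ b) :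
    ∃ C : ℕ, ∀ x y : ℤ, (h (x • b 0 + y • b 1) : ℤ) ≤ C * (x ^ 2 + y ^ 2) := by
  have hind : ∀ x y : ℤ, x • b 0 + y • b 1 = 0 → x = 0 ∧ y = 0 := by
    have e : ![b 0, b 1] = b := by
      ext i
      fin_cases i <;> rfl
    exact LinearIndependent.pair_iff.1 (by rw [e]; exact hb)
  obtain ⟨C₀, h₀⟩ := hh.exists_zsmul_le (hb.ne_zero 0)
  obtain ⟨C₁, h₁⟩ := hh.exists_zsmul_le (hb.ne_zero 1)
  refine ⟨2 * (C₀ + C₁), fun x y => ?_⟩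
  have hC₀ : (0 : ℤ) ≤ C₀ := Int.natCast_nonneg _
  have hC₁ : (0 : ℤ) ≤ C₁ := Int.natCast_nonneg _
  have p1 := mul_nonneg hC₀ (sq_nonneg x)
  have p2 := mul_nonneg hC₀ (sq_nonneg y)
  have p3 := mul_nonneg hC₁ (sq_nonneg x)
  have p4 := mul_nonneg hC₁ (sq_nonneg y)
  push_cast
  by_cases hx : x = 0
  · subst hx
    rw [zero_smul, zero_add]
    nlinarith [h₁ y]
  by_cases hy : y = 0
  · subst hy
    rw [zero_smul, add_zero]
    nlinarith [h₀ x]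
  have h2 := hh.2 (x • b 0) (y • b 1) (smul_ne_zero hx (hb.ne_zero 0)) (smul_ne_zero hy (hb.ne_zero 1))
    (fun h => hx (hind x y h).1) (fun h => hx (hind x (-y) (by rw [neg_smul, ← sub_eq_add_neg, h])).1)
  have h3 : (h (x • b 0 + y • b 1) : ℤ) + h (x • b 0 - y • b 1) ≤ 2 * (h (x • b 0) + h (y • b 1)) := by
    exact_mod_cast h2
  have h4 : (0 : ℤ) ≤ h (x • b 0 - y • b 1) := Int.natCast_nonneg _
  nlinarith [h₀ x, h₁ y]

end Growth

/-! ### Norms and ideals in imaginary quadratic fields -/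

section ImaginaryQuadratic

variable {K : Type u} [Field K] [NumberField K]

lemma exists_embedding_norm_sq [IsTotallyComplex K] (hK : Module.finrank ℚ K = 2) :
    ∃ σ : K →+* ℂ, ∀ a : K, ‖σ a‖ ^ 2 = |(Algebra.norm ℚ a : ℝ)| := by
  have hcard : Fintype.card (InfinitePlace K) = 1 := by
    rw [InfinitePlace.card_eq_nrRealPlaces_add_nrComplexPlaces, IsTotallyComplex.nrRealPlaces_eq_zero]
    have := IsTotallyComplex.finrank (K := K)
    omega
  obtain ⟨w, hw⟩ := Fintype.card_eq_one_iff.1 hcard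
  refine ⟨w.embedding, fun a => ?_⟩
  have := InfinitePlace.prod_eq_abs_norm a
  rw [Finset.prod_eq_single w (fun b _ hb => absurd (hw b) hb) (fun h => absurd (Finset.mem_univ w) h),
    IsTotallyComplex.mult_eq] at this
  rw [InfinitePlace.norm_embedding_eq, this]
  push_cast
  rfl

/-- The norm is `‖σ a‖ ^ 2`, a positive definite form on the lattice `𝓞 K`, so it dominates a
multiple of `x ^ 2 + y ^ 2` in coordinates. -/
lemma exists_forall_le_norm [IsTotallyComplex K] (hK : Module.finrank ℚ K = 2)
    {h : 𝓞 K → ℕ} (hh : IsSubParallelogram h) :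
    ∃ C : ℝ, 0 ≤ C ∧ ∀ a : 𝓞 K, (h a : ℝ) ≤ C * (Algebra.norm ℤ a).natAbs := by
  obtain ⟨σ, hσ⟩ := exists_embedding_norm_sq hK
  have hrank : Module.finrank ℤ (𝓞 K) = 2 := by rw [RingOfIntegers.rank, hK]
  let b := Module.finBasisOfFinrankEq ℤ (𝓞 K) hrank
  obtain ⟨C, hC⟩ := hh.exists_zsmul_add_zsmul_le b.linearIndependent
  have hrepr (a : 𝓞 K) : ∃ x y : ℤ, a = x • b 0 + y • b 1 := by
    refine ⟨b.repr a 0, b.repr a 1, ?_⟩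
    conv_lhs => rw [← b.sum_repr a, Fin.sum_univ_two]
  let z : Fin 2 → ℂ := fun i => σ (b i)
  have hσrepr (x y : ℤ) : σ ((x • b 0 + y • b 1 : 𝓞 K) : K) = x * z 0 + y * z 1 := by
    simp [z]
  -- Up to sign, `δ` is the covolume of the lattice. If it were zero, pairing with `1` would make
  -- every `σ a` real; when nonzero, it recovers `x` and `y` from the imaginary parts of `t` times
  -- the conjugates of `z 1` and `z 0`.
  let δ := (z 0 * starRingEnd ℂ (z 1)).im
  have hδ : δ ≠ 0 := by
    intro h0
    have hreal (a : 𝓞 K) : (σ a).im = 0 := by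
      obtain ⟨x, y, rfl⟩ := hrepr a
      obtain ⟨x', y', h1⟩ := hrepr 1
      have h2 := congrArg (fun t : 𝓞 K => σ (t : K)) h1
      simp only [hσrepr] at h2
      have h2' : x' * z 0 + y' * z 1 = 1 := by rw [← h2]; simp
      rw [hσrepr]
      have h3 : (((x : ℂ) * z 0 + y * z 1) * starRingEnd ℂ (x' * z 0 + y' * z 1)).im =
          (x * y' - y * x') * δ := by
        simp [δ]
        ring
      rw [h2', h0, mul_zero, map_one, mul_one] at h3
      exact h3
    refine IsTotallyComplex.complexEmbedding_not_isReal σ ?_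
    rw [ComplexEmbedding.isReal_iff]
    ext k
    obtain ⟨a, c, hc, rfl⟩ := IsFractionRing.div_surjective (A := 𝓞 K) k
    rw [ComplexEmbedding.conjugate_coe_eq, map_div₀, map_div₀,
      Complex.conj_eq_iff_im.2 (hreal a), Complex.conj_eq_iff_im.2 (hreal c)]
  refine ⟨C * ((‖z 0‖ ^ 2 + ‖z 1‖ ^ 2) / δ ^ 2), by positivity, fun a => ?_⟩
  have hn : ((Algebra.norm ℤ a).natAbs : ℝ) = ‖σ a‖ ^ 2 := by
    rw [hσ, ← Algebra.coe_norm_int]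
    simp
  rw [hn]
  obtain ⟨x, y, rfl⟩ := hrepr a
  have h1 : (h (x • b 0 + y • b 1) : ℝ) ≤ C * ((x : ℝ) ^ 2 + (y : ℝ) ^ 2) := by
    exact_mod_cast hC x y
  refine h1.trans ?_
  rw [mul_assoc]
  refine mul_le_mul_of_nonneg_left ?_ (Nat.cast_nonneg C)
  rw [div_mul_eq_mul_div, le_div_iff₀ (by positivity), hσrepr]
  set t : ℂ := x * z 0 + y * z 1 with ht
  have hx : (t * starRingEnd ℂ (z 1)).im = x * δ := by
    simp [ht, δ]
    ring
  have hy : (t * starRingEnd ℂ (z 0)).im = -(y * δ) := by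
    simp [ht, δ]
    ring
  have hx' : (x * δ) ^ 2 ≤ (‖t‖ * ‖z 1‖) ^ 2 := by
    rw [← hx, ← sq_abs]
    have := Complex.abs_im_le_norm (t * starRingEnd ℂ (z 1))
    rw [norm_mul, RCLike.norm_conj] at this
    gcongr
  have hy' : (y * δ) ^ 2 ≤ (‖t‖ * ‖z 0‖) ^ 2 := by
    rw [← neg_sq, ← hy, ← sq_abs]
    have := Complex.abs_im_le_norm (t * starRingEnd ℂ (z 0))
    rw [norm_mul, RCLike.norm_conj] at this
    gcongr
  linarith [mul_pow (x : ℝ) δ 2, mul_pow (y : ℝ) δ 2, mul_pow ‖t‖ ‖z 1‖ 2, mul_pow ‖t‖ ‖z 0‖ 2]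

/-- The class number is an exponent for the class group. -/
lemma HeightOneSpectrum.exists_pow_eq_span (𝔭 : HeightOneSpectrum (𝓞 K)) :
    ∃ m, 0 < m ∧ ∃ α : 𝓞 K, 𝔭.asIdeal ^ m = Ideal.span {α} := by
  let I : nonZeroDivisors (Ideal (𝓞 K)) := ⟨𝔭.asIdeal, mem_nonZeroDivisors_of_ne_zero 𝔭.ne_bot⟩
  refine ⟨Fintype.card (ClassGroup (𝓞 K)), Fintype.card_pos, ?_⟩
  have h1 : ClassGroup.mk0 (I ^ Fintype.card (ClassGroup (𝓞 K))) = 1 := by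
    rw [map_pow, pow_card_eq_one]
  obtain ⟨α, hα⟩ := ((ClassGroup.mk0_eq_one_iff (I ^ Fintype.card (ClassGroup (𝓞 K))).2).1 h1).principal
  exact ⟨α, hα⟩

lemma absNorm_eq_of_span_eq_mul (hK : Module.finrank ℚ K = 2) {p : ℕ} (hp : p.Prime)
    {𝔭 𝔭' : HeightOneSpectrum (𝓞 K)}
    (hsplit : Ideal.span {(p : 𝓞 K)} = 𝔭.asIdeal * 𝔭'.asIdeal) : Ideal.absNorm 𝔭.asIdeal = p := by
  have h1 : Ideal.absNorm 𝔭.asIdeal * Ideal.absNorm 𝔭'.asIdeal = p ^ 2 := by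
    rw [← map_mul, ← hsplit, Ideal.absNorm_span_natCast, RingOfIntegers.rank, hK]
  exact ((hp.mul_eq_prime_sq_iff (fun h => 𝔭.isPrime.ne_top (Ideal.absNorm_eq_one_iff.1 h))
    (fun h => 𝔭'.isPrime.ne_top (Ideal.absNorm_eq_one_iff.1 h))).1 h1).1

end ImaginaryQuadratic

/-! ### Kernels of complex multiplications -/

namespace CMByIntegers

open WeierstrassCurve.Affine.Point

variable {K : Type u} [Field K] {W : WeierstrassCurve.Affine K} {Kbar : Type v} [Field Kbar]
  [Algebra K Kbar] [DecidableEq Kbar] (ι : CMByIntegers W Kbar)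

lemma toEnd_mul_apply (a b : 𝓞 K) (P : (W.baseChange Kbar).Point) :
    ι.toEnd (a * b) P = ι.toEnd a (ι.toEnd b P) := by
  rw [map_mul]; rfl

lemma toEnd_add_apply (a b : 𝓞 K) (P : (W.baseChange Kbar).Point) :
    ι.toEnd (a + b) P = ι.toEnd a P + ι.toEnd b P := by
  rw [map_add]; rfl

lemma toEnd_natCast_apply (n : ℕ) (P : (W.baseChange Kbar).Point) : ι.toEnd (n : 𝓞 K) P = n • P := by
  rw [map_natCast]; rfl

lemma toEnd_one_apply (P : (W.baseChange Kbar).Point) : ι.toEnd 1 P = P := by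
  rw [map_one]; rfl

section Degree

variable [NumberField K]

lemma nsmul_toEnd_ne_zero {a : 𝓞 K} (ha : a ≠ 0) (N : ℕ) (hN : 0 < N) : N • ι.toEnd a ≠ 0 := by
  rw [← map_nsmul, ← _root_.map_zero ι.toEnd]
  exact fun h => smul_ne_zero hN.ne' ha (ι.injective h)

variable [IsAlgClosure K Kbar] [W.IsElliptic]

/-- The degrees of the `x`-coordinate maps of the endomorphisms `[a]`. -/
lemma exists_degree : ∃ h : 𝓞 K → ℕ, IsSubParallelogram h ∧
    ∀ a ≠ 0, ∃ r s, IsXMap (ι.toEnd a) r s ∧ ratDegree r s = h a := by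
  classical
  have : IsAlgClosed Kbar := IsAlgClosure.isAlgClosed K
  have : CharZero Kbar := charZero_of_injective_algebraMap (FaithfulSMul.algebraMap_injective K Kbar)
  have hex (a : 𝓞 K) (ha : a ≠ 0) : ∃ r s, IsXMap (ι.toEnd a) r s :=
    ((ι.mem_range_iff _).1 ⟨a, rfl⟩).exists_isXMap (by
      rw [← _root_.map_zero ι.toEnd]
      exact fun h => ha (ι.injective h))
  choose r s hrs using hex
  refine ⟨fun a => if ha : a = 0 then 0 else ratDegree (r a ha) (s a ha), ⟨by simp, ?_⟩, fun a ha => ?_⟩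
  · intro a b ha hb hab hab'
    simp only [ha, hb, hab, hab', dif_neg, not_false_eq_true]
    have h1 := hrs (a + b) hab
    have h2 := hrs (a - b) hab'
    rw [map_add] at h1
    rw [map_sub] at h2
    exact (hrs a ha).ratDegree_add_le (hrs b hb) h1 h2
  · exact ⟨_, _, hrs a ha, by simp [ha]⟩

lemma toEnd_surjective {a : 𝓞 K} (ha : a ≠ 0) : Function.Surjective (ι.toEnd a) := by
  have : IsAlgClosed Kbar := IsAlgClosure.isAlgClosed K
  obtain ⟨h, -, hh⟩ := ι.exists_degree
  obtain ⟨r, s, hrs, -⟩ := hh a ha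
  exact hrs.surjective (ι.nsmul_toEnd_ne_zero ha)

/-- The order of the kernel of `[a]` is bounded by a multiple of the norm of `a`. -/
lemma exists_card_ker_le [IsTotallyComplex K] (hK : Module.finrank ℚ K = 2) :
    ∃ C : ℝ, ∀ a : 𝓞 K, a ≠ 0 → Finite {P // ι.toEnd a P = 0} ∧
      (Nat.card {P // ι.toEnd a P = 0} : ℝ) ≤ C * (Algebra.norm ℤ a).natAbs := by
  have : IsAlgClosed Kbar := IsAlgClosure.isAlgClosed K
  obtain ⟨h, hpar, hh⟩ := ι.exists_degree
  obtain ⟨C, hC0, hC⟩ := exists_forall_le_norm hK hpar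
  refine ⟨2 * C, fun a ha => ?_⟩
  obtain ⟨r, s, hrs, hd⟩ := hh a ha
  obtain ⟨h1, h2⟩ := hrs.ncard_ker_le (ι.toEnd_surjective ha)
    (hrs.ratDegree_pos (ι.nsmul_toEnd_ne_zero ha))
  refine ⟨h1.to_subtype, ?_⟩
  rw [hd] at h2
  have h3 : (Nat.card {P // ι.toEnd a P = 0} : ℝ) ≤ 2 * h a := by
    exact_mod_cast h2
  have h4 := hC a
  linarith

/-- The kernel of `[a]` has at most `N(a)` elements. -/
lemma card_ker_le [IsTotallyComplex K] (hK : Module.finrank ℚ K = 2) {a : 𝓞 K} (ha : a ≠ 0) :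
    Nat.card {P // ι.toEnd a P = 0} ≤ (Algebra.norm ℤ a).natAbs := by
  obtain ⟨C, hC⟩ := ι.exists_card_ker_le hK
  -- Both the norm and the lower bound for the kernel are multiplicative in powers of `a`, so
  -- comparing growth rates removes `C`.
  refine le_of_forall_pow_le (C := C) (Int.natAbs_pos.2 (Algebra.norm_ne_zero_iff.2 ha)) fun n => ?_
  have h1 := card_ker_pow_le (ι.toEnd_surjective ha) n fun n => by
    rw [← map_pow]
    exact (hC _ (pow_ne_zero n ha)).1
  rw [← map_pow] at h1
  have h2 := (hC _ (pow_ne_zero n ha)).2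
  rw [map_pow (Algebra.norm ℤ) a n, Int.natAbs_pow, Nat.cast_pow] at h2
  exact le_trans (by exact_mod_cast h1) h2

end Degree

/-! ### The structure of `E[𝔭^∞]` -/

section PrimaryTorsion

variable {p : ℕ} {𝔭 𝔭' : HeightOneSpectrum (𝓞 K)}

lemma exists_pow_smul_eq_zero (hsplit : Ideal.span {(p : 𝓞 K)} = 𝔭.asIdeal * 𝔭'.asIdeal)
    {P : (W.baseChange Kbar).Point} (hP : P ∈ ι.primaryTorsion 𝔭) : ∃ n : ℕ, p ^ n • P = 0 := by
  obtain ⟨n, hn⟩ := hP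
  refine ⟨n, ?_⟩
  rw [← ι.toEnd_natCast_apply, Nat.cast_pow]
  have hmem : (p : 𝓞 K) ∈ 𝔭.asIdeal := by
    have h : (p : 𝓞 K) ∈ 𝔭.asIdeal * 𝔭'.asIdeal := by
      rw [← hsplit]
      exact Ideal.mem_span_singleton_self _
    exact (Ideal.mul_le_inf h).1
  have hpow : (p : 𝓞 K) ^ n ∈ 𝔭.asIdeal ^ n := Ideal.pow_mem_pow hmem n
  exact hn ((p : 𝓞 K) ^ n) hpow

variable [NumberField K]

/-- By coprimality of the two primes. The element `e` acts as the identity on `𝔭 ^ n`-torsion and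
multiplies `𝔭 ^ m` into `(p ^ m)`, so it projects to the `𝔭`-part. -/
lemma exists_sub_one_mem (hne : 𝔭 ≠ 𝔭') (m n : ℕ) :
    ∃ e ∈ 𝔭'.asIdeal ^ m, ∃ d ∈ 𝔭.asIdeal ^ n, d + e = 1 := by
  have hcop : IsCoprime 𝔭.asIdeal 𝔭'.asIdeal := by
    rw [Ideal.isCoprime_iff_sup_eq]
    exact 𝔭.isMaximal.coprime_of_ne 𝔭'.isMaximal fun h => hne (HeightOneSpectrum.ext h)
  obtain ⟨d, hd, e, he, hde⟩ := Ideal.isCoprime_iff_exists.1 (hcop.pow (m := n) (n := m))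
  exact ⟨e, he, d, hd, hde⟩

lemma exists_smul_eq [IsAlgClosure K Kbar] [W.IsElliptic] (hp : p ≠ 0) (hne : 𝔭 ≠ 𝔭')
    (hsplit : Ideal.span {(p : 𝓞 K)} = 𝔭.asIdeal * 𝔭'.asIdeal)
    {P : (W.baseChange Kbar).Point} (hP : P ∈ ι.primaryTorsion 𝔭) :
    ∃ Q ∈ ι.primaryTorsion 𝔭, p • Q = P := by
  obtain ⟨n, hn⟩ := hP
  obtain ⟨Q, hQ⟩ := ι.toEnd_surjective (a := (p : 𝓞 K)) (by exact_mod_cast hp) P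
  obtain ⟨e, he, d, hd, hde⟩ := exists_sub_one_mem hne 1 n
  rw [pow_one] at he
  -- `Q` is any `p`-division point of `P`, and `e` projects it to the `𝔭`-part; the exponent is `n +
  -- 1` because `𝔭 ^ (n + 1) * 𝔭' = 𝔭 ^ n * (p)`.
  refine ⟨ι.toEnd e Q, ⟨n + 1, fun a ha => ?_⟩, ?_⟩
  · have h1 : a * e ∈ 𝔭.asIdeal ^ n * Ideal.span {(p : 𝓞 K)} := by
      rw [hsplit, ← mul_assoc, ← pow_succ]
      exact Ideal.mul_mem_mul ha he
    obtain ⟨c, hc, hce⟩ := Ideal.mem_mul_span_singleton.1 h1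
    rw [← toEnd_mul_apply, ← hce, toEnd_mul_apply, hQ, hn c hc]
  · rw [← toEnd_natCast_apply, ← toEnd_mul_apply, mul_comm, toEnd_mul_apply, hQ]
    have := ι.toEnd_add_apply d e P
    rwa [hde, toEnd_one_apply, hn d hd, zero_add, eq_comm] at this

lemma toEnd_apply_eq_zero (hne : 𝔭 ≠ 𝔭')
    (hsplit : Ideal.span {(p : 𝓞 K)} = 𝔭.asIdeal * 𝔭'.asIdeal) {m : ℕ}
    {P : (W.baseChange Kbar).Point} (hP : P ∈ ι.primaryTorsion 𝔭) (hpP : p ^ m • P = 0)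
    {a : 𝓞 K} (ha : a ∈ 𝔭.asIdeal ^ m) : ι.toEnd a P = 0 := by
  obtain ⟨n, hn⟩ := hP
  obtain ⟨e, he, d, hd, hde⟩ := exists_sub_one_mem hne m n
  have h1 : a * e ∈ Ideal.span {(p : 𝓞 K) ^ m} := by
    rw [← Ideal.span_singleton_pow, hsplit, mul_pow]
    exact Ideal.mul_mem_mul ha he
  obtain ⟨c, hc⟩ := Ideal.mem_span_singleton'.1 h1
  have h2 : ι.toEnd e P = P := by
    have := ι.toEnd_add_apply d e P
    rwa [hde, toEnd_one_apply, hn d hd, zero_add, eq_comm] at this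
  rw [← h2, ← toEnd_mul_apply, ← hc, toEnd_mul_apply, ← Nat.cast_pow, toEnd_natCast_apply, hpP, _root_.map_zero]

variable [IsTotallyComplex K] [IsAlgClosure K Kbar] [W.IsElliptic]

/-- Since `𝔭` need not be principal, the bound on kernels is applied to a generator `α` of `𝔭 ^ m`,
of norm `p ^ m`. It bounds the `p ^ m`-torsion of `E[𝔭^∞]`, and divisibility brings this down to the
`p`-torsion by extracting an `m`-th root. -/
lemma card_torsion_le (hK : Module.finrank ℚ K = 2) (hp : p.Prime) (hne : 𝔭 ≠ 𝔭')
    (hsplit : Ideal.span {(p : 𝓞 K)} = 𝔭.asIdeal * 𝔭'.asIdeal) :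
    Finite {x : ι.primaryTorsion 𝔭 // p • x = 0} ∧
      Nat.card {x : ι.primaryTorsion 𝔭 // p • x = 0} ≤ p := by
  obtain ⟨m, hm, α, hα⟩ := HeightOneSpectrum.exists_pow_eq_span 𝔭
  have hnorm : (Algebra.norm ℤ α).natAbs = p ^ m := by
    rw [← Ideal.absNorm_span_singleton, ← hα, map_pow, absNorm_eq_of_span_eq_mul hK hp hsplit]
  have hα0 : α ≠ 0 := by
    rintro rfl
    rw [Algebra.norm_zero] at hnorm
    exact pow_ne_zero m hp.ne_zero hnorm.symm
  have hfin (n : ℕ) : Finite {x : ι.primaryTorsion 𝔭 // p ^ n • x = 0} := by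
    obtain ⟨C, hC⟩ := ι.exists_card_ker_le hK
    have := (hC (p ^ n : ℕ) (by exact_mod_cast pow_ne_zero n hp.ne_zero)).1
    refine Finite.of_injective (β := {P // ι.toEnd ((p ^ n : ℕ) : 𝓞 K) P = 0})
      (fun x => ⟨x.1.1, ?_⟩) fun x y h => ?_
    · rw [toEnd_natCast_apply]
      exact congrArg Subtype.val x.2
    · exact Subtype.ext (Subtype.ext (Subtype.mk.inj h))
  let u : AddMonoid.End (ι.primaryTorsion 𝔭) := (p : AddMonoid.End (ι.primaryTorsion 𝔭))
  have hu (n : ℕ) (x : ι.primaryTorsion 𝔭) : (u ^ n) x = p ^ n • x := by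
    change ((p : AddMonoid.End (ι.primaryTorsion 𝔭)) ^ n) x = _
    rw [← Nat.cast_pow]
    rfl
  have husurj : Function.Surjective u := by
    intro x
    obtain ⟨Q, hQ, hQ'⟩ := ι.exists_smul_eq hp.ne_zero hne hsplit x.2
    exact ⟨⟨Q, hQ⟩, Subtype.ext hQ'⟩
  have h1 := card_ker_pow_le husurj m fun n => by simpa only [hu] using hfin n
  have h2 : Nat.card {x // (u ^ m) x = 0} ≤ p ^ m := by
    have hker := ι.card_ker_le hK hα0
    rw [hnorm] at hker
    obtain ⟨C, hC⟩ := ι.exists_card_ker_le hK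
    have := (hC α hα0).1
    refine (Nat.card_le_card_of_injective (β := {P // ι.toEnd α P = 0})
      (fun x => ⟨x.1.1, ?_⟩) fun x y h => ?_).trans hker
    · have h3 := x.2
      rw [hu] at h3
      exact ι.toEnd_apply_eq_zero hne hsplit x.1.2 (congrArg Subtype.val h3)
        (hα ▸ Ideal.mem_span_singleton_self α)
    · exact Subtype.ext (Subtype.ext (Subtype.mk.inj h))
  refine ⟨by simpa using hfin 1, ?_⟩
  exact (Nat.pow_le_pow_iff_left hm.ne').1 (h1.trans h2)

/-- The module `E[𝔭^∞]` is `p`-quasi-cyclic. -/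
theorem isQuasiCyclic_primaryTorsion (hK : Module.finrank ℚ K = 2) (hp : p.Prime) (hne : 𝔭 ≠ 𝔭')
    (hsplit : Ideal.span {(p : 𝓞 K)} = 𝔭.asIdeal * 𝔭'.asIdeal) :
    IsQuasiCyclic p (ι.primaryTorsion 𝔭) where
  exists_pow_smul_eq_zero x := by
    obtain ⟨n, hn⟩ := ι.exists_pow_smul_eq_zero hsplit x.2
    exact ⟨n, Subtype.ext hn⟩
  exists_smul_eq x := by
    obtain ⟨Q, hQ, hQ'⟩ := ι.exists_smul_eq hp.ne_zero hne hsplit x.2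
    exact ⟨⟨Q, hQ⟩, Subtype.ext hQ'⟩
  exists_eq_smul x y hx hx0 hy := by
    obtain ⟨hfin, hcard⟩ := ι.card_torsion_le hK hp hne hsplit
    have hord : addOrderOf x = p := by
      have := Fact.mk hp
      exact addOrderOf_eq_prime hx hx0
    have hsub : (AddSubgroup.zmultiples x : Set (ι.primaryTorsion 𝔭)) ⊆ {x | p • x = 0} := by
      rintro _ ⟨k, rfl⟩
      change p • (k • x) = 0
      rw [smul_comm, hx, smul_zero]
    have hcx : (AddSubgroup.zmultiples x : Set (ι.primaryTorsion 𝔭)).ncard = p := by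
      rw [← hord, ← Nat.card_zmultiples]
      rfl
    have hfin' : {x : ι.primaryTorsion 𝔭 | p • x = 0}.Finite := hfin
    -- A nonzero `p`-torsion element already has `p` multiples, as many as the whole `p`-torsion can
    -- contain.
    have heq := Set.eq_of_subset_of_ncard_le hsub (by rw [hcx]; exact hcard) hfin'
    have hy' : y ∈ AddSubgroup.zmultiples x := by
      rw [← SetLike.mem_coe, heq]
      exact hy
    have hfo : IsOfFinAddOrder x := addOrderOf_pos_iff.1 (hord ▸ hp.pos)
    obtain ⟨n, hn⟩ := hfo.mem_multiples_iff_mem_zmultiples.2 hy'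
    exact ⟨n, hn.symm⟩

end PrimaryTorsion

/-! ### The Galois action on `E[𝔭^∞]` and the field it cuts out -/

section Galois

variable [IsAlgClosure K Kbar] [W.IsElliptic] {𝔭 : HeightOneSpectrum (𝓞 K)}

lemma galoisRep_some_eq_iff {x y : Kbar} {h : (W.baseChange Kbar).Nonsingular x y}
    (hP : .some x y h ∈ ι.primaryTorsion 𝔭) (σ : Gal(Kbar/K)) :
    ι.galoisRep 𝔭 σ ⟨.some x y h, hP⟩ = ⟨.some x y h, hP⟩ ↔ σ x = x ∧ σ y = y := by
  rw [Subtype.ext_iff]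
  change WeierstrassCurve.Affine.Point.some (σ x) (σ y) _ = .some x y h ↔ _
  exact WeierstrassCurve.Affine.Point.some.injEq _ _ _ _ _ _ |>.to_iff

lemma isOpen_galoisRep_eq (P : ι.primaryTorsion 𝔭) : IsOpen {σ | ι.galoisRep 𝔭 σ P = P} := by
  obtain ⟨_ | ⟨x, y, h⟩, hP⟩ := P
  · convert isOpen_univ
    exact Set.eq_univ_of_forall fun σ => _root_.map_zero (ι.galoisRep 𝔭 σ)
  have : Algebra.IsAlgebraic K Kbar := IsAlgClosure.isAlgebraic
  convert (stabilizer_isOpen_of_isIntegral (K := K) x).inter (stabilizer_isOpen_of_isIntegral (K := K) y)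
  ext σ
  exact ι.galoisRep_some_eq_iff hP σ

/-- Fixing a point means fixing its two coordinates, and these generate the division field over `L`.
This identifies `Gal(Kbar/L^𝔭)` with the kernel of the action of `Gal(Kbar/L)`. -/
lemma mem_fixingSubgroup_divisionField_iff (L : IntermediateField K Kbar) (σ : Gal(Kbar/K)) :
    σ ∈ (ι.divisionField 𝔭 L).fixingSubgroup ↔
      σ ∈ L.fixingSubgroup ∧ ∀ P, ι.galoisRep 𝔭 σ P = P := by
  rw [divisionField, IntermediateField.fixingSubgroup_sup, Subgroup.mem_inf]
  refine and_congr_right fun _ => ?_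
  rw [IntermediateField.mem_fixingSubgroup_iff]
  constructor
  · rintro h ⟨_ | ⟨x, y, hxy⟩, hP⟩
    · exact _root_.map_zero (ι.galoisRep 𝔭 σ)
    · exact (ι.galoisRep_some_eq_iff hP σ).2
        ⟨h _ (IntermediateField.subset_adjoin _ _ ⟨x, y, hxy, hP, Or.inl rfl⟩),
          h _ (IntermediateField.subset_adjoin _ _ ⟨x, y, hxy, hP, Or.inr rfl⟩)⟩
  · intro h z hz
    induction hz using IntermediateField.adjoin_induction with
    | mem z hz =>
      obtain ⟨x, y, hxy, hP, rfl | rfl⟩ := hz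
      · exact ((ι.galoisRep_some_eq_iff hP σ).1 (h _)).1
      · exact ((ι.galoisRep_some_eq_iff hP σ).1 (h _)).2
    | algebraMap x => exact AlgEquiv.commutes _ x
    | add x y _ _ hx hy => rw [map_add, hx, hy]
    | inv x _ hx => rw [map_inv₀, hx]
    | mul x y _ _ hx hy => rw [map_mul, hx, hy]

end Galois

end CMByIntegers

/-! ### The control theorem for `E[𝔭^∞]` -/

theorem mainTheorem7 {K : Type u} [Field K] [NumberField K] [IsTotallyComplex K]
    (hK : Module.finrank ℚ K = 2)
    (p : ℕ) [Fact p.Prime] (hp : 5 ≤ p)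
    (𝔭 𝔭' : HeightOneSpectrum (𝓞 K)) (hne : 𝔭 ≠ 𝔭')
    (hsplit : Ideal.span {(p : 𝓞 K)} = 𝔭.asIdeal * 𝔭'.asIdeal)
    {Kbar : Type v} [Field Kbar] [Algebra K Kbar] [IsAlgClosure K Kbar]
    [DecidableEq Kbar]
    (E : WeierstrassCurve ℚ) [E.IsElliptic]
    (hgood : ((E.baseChange ℚ_[p]).minimal ℤ_[p]).HasGoodReduction ℤ_[p])
    (ι : CMByIntegers (E.baseChange K) Kbar)
    (L : IntermediateField K Kbar) [FiniteDimensional K L] [IsAbelianGalois K L]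
    (S : Finset (HeightOneSpectrum (𝓞 K))) (hS : 𝔭 ∈ S) (hS' : 𝔭' ∉ S) :
    (∃ e : imprimitiveSelmer (ι.galoisRep 𝔭) S L ≃+
        selmerInvariants (ι.galoisRep 𝔭) S L (ι.divisionField 𝔭 L),
      ∀ c : imprimitiveSelmer (ι.galoisRep 𝔭) S L,
        (e c : galH1 (ι.galoisRep 𝔭) (ι.divisionField 𝔭 L)) =
          galRes (ι.galoisRep 𝔭) (ι.le_divisionField 𝔭 L) c) ∧
    (∀ (σ : Gal(Kbar/K)) (c : galH1 (ι.galoisRep 𝔭) L),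
      galRes (ι.galoisRep 𝔭) (ι.le_divisionField 𝔭 L) (galConj (ι.galoisRep 𝔭) L σ c) =
        galConj (ι.galoisRep 𝔭) (ι.divisionField 𝔭 L) σ
          (galRes (ι.galoisRep 𝔭) (ι.le_divisionField 𝔭 L) c)) := by
  have hp' : p.Prime := Fact.out
  have hp2 : p ≠ 2 := by omega
  have hA := ι.isQuasiCyclic_primaryTorsion hK hp' hne hsplit
  exact ⟨exists_selmer_equiv hA hp' hp2 ι.isOpen_galoisRep_eq (ι.le_divisionField 𝔭 L)
    (ι.mem_fixingSubgroup_divisionField_iff L) S, fun σ c => galConj_galRes _ σ c⟩
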